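/- All monoidal categories and monoidal functors below are strict. A \emph{monoidal equational theory} consists of a set $E_1$ of generators for objects, a set $E_2$ of generators for morphisms, each with a source and a target in the free monoid $E_1^*$, and a set $E_3$ of relations, each a pair of parallel morphisms of the free strict monoidal category $\mathcal{E}$ on the signature (objects: the elements of $E_1^*$; morphisms: formal composites and tensor products of generators modulo the laws of strict monoidal categories). It generates the strict monoidal category $\mathcal{E}/{\equiv}$, where $\equiv$ is the smallest congruence with respect to composition and tensor product that contains the relations. The theory is a \emph{presentation} of a strict monoidal category $\mathcal{M}$ when $\mathcal{M}$ and $\mathcal{E}/{\equiv}$ are monoidally equivalent, i.e. there are strict monoidal functors $F$ and $G$ between them in opposite directions and invertible monoidal natural transformations $\mathrm{Id}\to GF$ and $FG\to\mathrm{Id}$. The \emph{theory of bicommutative bialgebras} has one generator for objects, denoted $1$ (so that its objects are the natural numbers, with addition as tensor product), five generators for morphisms $$\mu:2\to 1,\qquad \eta:0\to 1,\qquad \delta:1\to 2,\qquad \varepsilon:1\to 0,\qquad \gamma:2\to 2,$$ and the following twenty-two relations, where $1$ also denotes the identity of the object $1$: (symmetry) $(1\otimes\gamma)\circ(\gamma\otimes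 1)\circ(1\otimes\gamma)=(\gamma\otimes 1)\circ(1\otimes\gamma)\circ(\gamma\otimes 1)$ and $\gamma\circ\gamma=\mathrm{id}_2$; (commutative monoid) $\mu\circ(\mu\otimes 1)=\mu\circ(1\otimes\mu)$, $\ \mu\circ(\eta\otimes 1)=1$, $\ \mu\circ(1\otimes\eta)=1$, $\ \gamma\circ(\mu\otimes 1)=(1\otimes\mu)\circ(\gamma\otimes 1)\circ(1\otimes\gamma)$, $\ \gamma\circ(1\otimes\mu)=(\mu\otimes 1)\circ(1\otimes\gamma)\circ(\gamma\otimes 1)$, $\ \gamma\circ(\eta\otimes 1)=1\otimes\eta$, $\ \gamma\circ(1\otimes\eta)=\eta\otimes 1$, $\ \mu\circ\gamma=\mu$; (cocommutative comonoid) $(\delta\otimes 1)\circ\delta=(1\otimes\delta)\circ\delta$, $\ (\varepsilon\otimes 1)\circ\delta=1$, $\ (1\otimes\varepsilon)\circ\delta=1$, $\ (\delta\otimes 1)\circ\gamma=(1\otimes\gamma)\circ(\gamma\otimes 1)\circ(1\otimes\delta)$, $\ (1\otimes\delta)\circ\gamma=(\gamma\otimes 1)\circ(1\otimes\gamma)\circ(\delta\otimes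 1)$, $\ (\varepsilon\otimes 1)\circ\gamma=1\otimes\varepsilon$, $\ (1\otimes\varepsilon)\circ\gamma=\varepsilon\otimes 1$, $\ \gamma\circ\delta=\delta$; (compatibility) $\delta\circ\mu=(\mu\otimes\mu)\circ(1\otimes\gamma\otimes 1)\circ(\delta\otimes\delta)$, $\ \delta\circ\eta=\eta\otimes\eta$, $\ \varepsilon\circ\mu=\varepsilon\otimes\varepsilon$, $\ \varepsilon\circ\eta=\mathrm{id}_0$. Let $\mathcal{B}$ be the free strict monoidal category on this signature and $\mathcal{B}/{\equiv}$ the category generated by the theory. Let $\mathbf{MRel}$ be the strict monoidal category whose objects are the finite ordinals $n=\{0,\dots,n-1\}$, whose morphisms $m\to n$ are the multirelations $R:m\times n\to\mathbb{N}$, with composition $(R_2\circ R_1)(a,c)=\sum_{b}R_1(a,b)\,R_2(b,c)$, and whose tensor product is the disjoint union, on objects (addition) and on morphisms (block-diagonal matrices). \textbf{Theorem.} There is an isomorphism of strict monoidal categories $\mathcal{B}/{\equiv}\;\cong\;\mathbf{MRel}$ (a strict monoidal functor with a strict monoidal inverse). It is the interpretation functor: it is the identity on objects, and it sends $\mu,\eta,\delta,\varepsilon,\gamma$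 respectively to the matrices $$\begin{pmatrix}1\\1\end{pmatrix},\qquad 0:0\to 1,\qquad \begin{pmatrix}1&1\end{pmatrix},\qquad 0:1\to 0,\qquad \begin{pmatrix}0&1\\1&0\end{pmatrix}.$$ In particular, the theory of bicommutative bialgebras is a presentation of $\mathbf{MRel}$. -/

import Mathlib

open CategoryTheory MonoidalCategory

universe u v w u₁ v₁ u₂ v₂

/-! ### Strict monoidal categories, strict monoidal functors, monoidal equivalence -/

/-- A monoidal category is strict when its associators and unitors are identities. As the types of
these morphisms involve different expressions for the same object, "identity" is expressed by
`eqToIso`, as in `CategoryTheory.Bicategory.Strict`. -/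
class StrictMonoidal (C : Type u) [Category.{v} C] [MonoidalCategory C] : Prop where
  assoc_obj : ∀ X Y Z : C, (X ⊗ Y) ⊗ Z = X ⊗ (Y ⊗ Z)
  unit_obj : ∀ X : C, 𝟙_ C ⊗ X = X
  obj_unit : ∀ X : C, X ⊗ 𝟙_ C = X
  associator_eq : ∀ X Y Z : C, α_ X Y Z = eqToIso (assoc_obj X Y Z)
  leftUnitor_eq : ∀ X : C, λ_ X = eqToIso (unit_obj X)
  rightUnitor_eq : ∀ X : C, ρ_ X = eqToIso (obj_unit X)

/-- The data of a strict tensor product on a category. -/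
structure StrictTensor (C : Type u) [Category.{v} C] where
  unit : C
  obj : C → C → C
  assoc_obj : ∀ X Y Z, obj (obj X Y) Z = obj X (obj Y Z)
  unit_obj : ∀ X, obj unit X = X
  obj_unit : ∀ X, obj X unit = X
  hom : ∀ {X₁ Y₁ X₂ Y₂ : C}, (X₁ ⟶ Y₁) → (X₂ ⟶ Y₂) → (obj X₁ X₂ ⟶ obj Y₁ Y₂)
  hom_id : ∀ X Y, hom (𝟙 X) (𝟙 Y) = 𝟙 (obj X Y)
  hom_comp : ∀ {X₁ Y₁ Z₁ X₂ Y₂ Z₂ : C} (f₁ : X₁ ⟶ Y₁) (f₂ : X₂ ⟶ Y₂)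
    (g₁ : Y₁ ⟶ Z₁) (g₂ : Y₂ ⟶ Z₂), hom f₁ f₂ ≫ hom g₁ g₂ = hom (f₁ ≫ g₁) (f₂ ≫ g₂)
  assoc_hom : ∀ {X₁ X₂ X₃ Y₁ Y₂ Y₃ : C} (f₁ : X₁ ⟶ Y₁) (f₂ : X₂ ⟶ Y₂) (f₃ : X₃ ⟶ Y₃),
    hom (hom f₁ f₂) f₃ ≫ eqToHom (assoc_obj Y₁ Y₂ Y₃) =
      eqToHom (assoc_obj X₁ X₂ X₃) ≫ hom f₁ (hom f₂ f₃)
  unit_hom : ∀ {X Y : C} (f : X ⟶ Y),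
    hom (𝟙 unit) f ≫ eqToHom (unit_obj Y) = eqToHom (unit_obj X) ≫ f
  hom_unit : ∀ {X Y : C} (f : X ⟶ Y),
    hom f (𝟙 unit) ≫ eqToHom (obj_unit Y) = eqToHom (obj_unit X) ≫ f

namespace StrictTensor

variable {C : Type u} [Category.{v} C] (T : StrictTensor C)

theorem hom_eqToHom_id {X Y : C} (h : X = Y) (Z : C) :
    T.hom (eqToHom h) (𝟙 Z) = eqToHom (by rw [h]) := by
  subst h; simp [T.hom_id]

theorem hom_id_eqToHom {X Y : C} (h : X = Y) (Z : C) :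
    T.hom (𝟙 Z) (eqToHom h) = eqToHom (by rw [h]) := by
  subst h; simp [T.hom_id]

theorem pentagon (W X Y Z : C) :
    T.hom (eqToHom (T.assoc_obj W X Y)) (𝟙 Z) ≫ eqToHom (T.assoc_obj W (T.obj X Y) Z) ≫
        T.hom (𝟙 W) (eqToHom (T.assoc_obj X Y Z)) =
      eqToHom (T.assoc_obj (T.obj W X) Y Z) ≫ eqToHom (T.assoc_obj W X (T.obj Y Z)) := by
  simp only [hom_eqToHom_id, hom_id_eqToHom, eqToHom_trans]

theorem triangle (X Y : C) :
    eqToHom (T.assoc_obj X T.unit Y) ≫ T.hom (𝟙 X) (eqToHom (T.unit_obj Y)) =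
      T.hom (eqToHom (T.obj_unit X)) (𝟙 Y) := by
  simp only [hom_eqToHom_id, hom_id_eqToHom, eqToHom_trans]

/-- The monoidal category defined by a strict tensor product. -/
abbrev monoidalCategory : MonoidalCategory C :=
  letI : MonoidalCategoryStruct C :=
    { tensorObj := T.obj
      whiskerLeft := fun X _ _ f => T.hom (𝟙 X) f
      whiskerRight := fun f Y => T.hom f (𝟙 Y)
      tensorHom := fun f g => T.hom f g
      tensorUnit := T.unit
      associator := fun X Y Z => eqToIso (T.assoc_obj X Y Z)
      leftUnitor := fun X => eqToIso (T.unit_obj X)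
      rightUnitor := fun X => eqToIso (T.obj_unit X) }
  MonoidalCategory.ofTensorHom
    (id_tensorHom_id := T.hom_id)
    (id_tensorHom := fun _ _ _ _ => rfl)
    (tensorHom_id := fun _ _ => rfl)
    (tensorHom_comp_tensorHom := T.hom_comp)
    (associator_naturality := T.assoc_hom)
    (leftUnitor_naturality := T.unit_hom)
    (rightUnitor_naturality := T.hom_unit)
    (pentagon := T.pentagon)
    (triangle := T.triangle)

theorem strictMonoidal : @StrictMonoidal C _ T.monoidalCategory :=
  letI := T.monoidalCategory
  { assoc_obj := T.assoc_obj
    unit_obj := T.unit_obj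
    obj_unit := T.obj_unit
    associator_eq := fun _ _ _ => rfl
    leftUnitor_eq := fun _ => rfl
    rightUnitor_eq := fun _ => rfl }

end StrictTensor

section StrictFunctors

variable {C : Type u} [Category.{v} C] [MonoidalCategory C]
variable {D : Type u₁} [Category.{v₁} D] [MonoidalCategory D]
variable {E : Type u₂} [Category.{v₂} E] [MonoidalCategory E]

/-- Strict monoidal functors: tensor product and unit are preserved on the nose. -/
structure IsStrictMonoidal (F : C ⥤ D) : Prop where
  unit_obj : F.obj (𝟙_ C) = 𝟙_ D
  tensor_obj : ∀ X Y : C, F.obj (X ⊗ Y) = F.obj X ⊗ F.obj Y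
  tensor_map : ∀ {X₁ Y₁ X₂ Y₂ : C} (f : X₁ ⟶ Y₁) (g : X₂ ⟶ Y₂),
    F.map (f ⊗ₘ g) =
      eqToHom (tensor_obj X₁ X₂) ≫ (F.map f ⊗ₘ F.map g) ≫ eqToHom (tensor_obj Y₁ Y₂).symm

/-- Monoidal natural transformations between strict monoidal functors: `θ_{X ⊗ Y} = θ_X ⊗ θ_Y` and
`θ_I = id_I`. -/
structure IsMonoidalTrans {F G : C ⥤ D} (hF : IsStrictMonoidal F) (hG : IsStrictMonoidal G)
    (θ : F ⟶ G) : Prop where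
  unit_app : θ.app (𝟙_ C) = eqToHom (hF.unit_obj.trans hG.unit_obj.symm)
  tensor_app : ∀ X Y : C, θ.app (X ⊗ Y) =
    eqToHom (hF.tensor_obj X Y) ≫ (θ.app X ⊗ₘ θ.app Y) ≫ eqToHom (hG.tensor_obj X Y).symm

theorem isStrictMonoidal_id : IsStrictMonoidal (𝟭 C) :=
  ⟨rfl, fun _ _ => rfl, fun _ _ => by simp⟩

theorem IsStrictMonoidal.comp {F : C ⥤ D} {G : D ⥤ E} (hF : IsStrictMonoidal F)
    (hG : IsStrictMonoidal G) : IsStrictMonoidal (F ⋙ G) where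
  unit_obj := (congrArg G.obj hF.unit_obj).trans hG.unit_obj
  tensor_obj X Y := (congrArg G.obj (hF.tensor_obj X Y)).trans (hG.tensor_obj _ _)
  tensor_map f g := by
    simp [hF.tensor_map, hG.tensor_map, eqToHom_map]

variable (C D)

/-- Monoidal equivalence of strict monoidal categories: strict monoidal functors `F` and `G` in
opposite directions, and invertible monoidal natural transformations `Id ⟶ GF` and `FG ⟶ Id`. -/
def MonoidallyEquivalent : Prop :=
  ∃ (F : C ⥤ D) (G : D ⥤ C) (hF : IsStrictMonoidal F) (hG : IsStrictMonoidal G)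
    (η : 𝟭 C ≅ F ⋙ G) (ε : G ⋙ F ≅ 𝟭 D),
    IsMonoidalTrans isStrictMonoidal_id (hF.comp hG) η.hom ∧
      IsMonoidalTrans (hG.comp hF) isStrictMonoidal_id ε.hom

end StrictFunctors

/-! ### Signatures and the free strict monoidal category on a signature -/

/-- A signature: generators `E₁` for objects and generators `E₂` for morphisms, each with a source
and a target in the free monoid on `E₁` (words in `E₁`, with concatenation). -/
structure Signature where
  E₁ : Type u
  E₂ : Type v
  s₁ : E₂ → List E₁
  t₁ : E₂ → List E₁

/-- Formal composites and tensor products of generators (`comp f g` is `g ∘ f`). -/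
inductive Signature.Term (S : Signature.{u, v}) : List S.E₁ → List S.E₁ → Type (max u v)
  | gen (x : S.E₂) : Signature.Term S (S.s₁ x) (S.t₁ x)
  | id (a : List S.E₁) : Signature.Term S a a
  | comp {a b c : List S.E₁} (f : Signature.Term S a b) (g : Signature.Term S b c) :
      Signature.Term S a c
  | tensor {a b c d : List S.E₁} (f : Signature.Term S a b) (g : Signature.Term S c d) :
      Signature.Term S (a ++ c) (b ++ d)

/-- The identity term, between two equal words. -/
def Signature.Term.ofEq {S : Signature.{u, v}} {a b : List S.E₁} (h : a = b) : S.Term a b :=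
  h ▸ Signature.Term.id a

/-- The laws of strict monoidal categories, as the least congruence on terms containing the
axioms. -/
inductive Signature.TermEq (S : Signature.{u, v}) :
    ∀ {a b : List S.E₁}, S.Term a b → S.Term a b → Prop
  | refl {a b} (f : S.Term a b) : Signature.TermEq S f f
  | symm {a b} {f g : S.Term a b} : Signature.TermEq S f g → Signature.TermEq S g f
  | trans {a b} {f g h : S.Term a b} :
      Signature.TermEq S f g → Signature.TermEq S g h → Signature.TermEq S f h
  | comp_congr {a b c} {f f' : S.Term a b} {g g' : S.Term b c} :
      Signature.TermEq S f f' → Signature.TermEq S g g' →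
        Signature.TermEq S (.comp f g) (.comp f' g')
  | tensor_congr {a b c d} {f f' : S.Term a b} {g g' : S.Term c d} :
      Signature.TermEq S f f' → Signature.TermEq S g g' →
        Signature.TermEq S (.tensor f g) (.tensor f' g')
  | id_comp {a b} (f : S.Term a b) : Signature.TermEq S (.comp (.id a) f) f
  | comp_id {a b} (f : S.Term a b) : Signature.TermEq S (.comp f (.id b)) f
  | assoc {a b c d} (f : S.Term a b) (g : S.Term b c) (h : S.Term c d) :
      Signature.TermEq S (.comp (.comp f g) h) (.comp f (.comp g h))
  | tensor_id (a b) : Signature.TermEq S (.tensor (.id a) (.id b)) (.id (a ++ b))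
  | interchange {a b c a' b' c'} (f : S.Term a b) (f' : S.Term a' b') (g : S.Term b c)
      (g' : S.Term b' c') :
      Signature.TermEq S (.comp (.tensor f f') (.tensor g g')) (.tensor (.comp f g) (.comp f' g'))
  | tensor_assoc {a b a' b' a'' b''} (f : S.Term a b) (f' : S.Term a' b') (f'' : S.Term a'' b'') :
      Signature.TermEq S
        (.comp (.tensor (.tensor f f') f'') (.ofEq (List.append_assoc b b' b'')))
        (.comp (.ofEq (List.append_assoc a a' a'')) (.tensor f (.tensor f' f'')))
  | unit_tensor {a b} (f : S.Term a b) :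
      Signature.TermEq S (.comp (.tensor (.id []) f) (.ofEq (List.nil_append b)))
        (.comp (.ofEq (List.nil_append a)) f)
  | tensor_unit {a b} (f : S.Term a b) :
      Signature.TermEq S (.comp (.tensor f (.id [])) (.ofEq (List.append_nil b)))
        (.comp (.ofEq (List.append_nil a)) f)

/-- The setoid of terms modulo the laws of strict monoidal categories. -/
def Signature.termSetoid (S : Signature.{u, v}) (a b : List S.E₁) : Setoid (S.Term a b) where
  r := Signature.TermEq S
  iseqv := ⟨.refl, .symm, .trans⟩

/-- The objects of the free strict monoidal category on a signature are the words in `E₁`. -/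
structure Signature.FreeCat (S : Signature.{u, v}) : Type u where
  word : List S.E₁

namespace Signature.FreeCat

variable {S : Signature.{u, v}}

instance category : Category.{max u v} S.FreeCat where
  Hom a b := Quotient (S.termSetoid a.word b.word)
  id a := Quotient.mk _ (.id a.word)
  comp f g := Quotient.map₂ Term.comp (fun _ _ h _ _ h' => TermEq.comp_congr h h') f g
  id_comp := by rintro a b ⟨f⟩; exact Quotient.sound (TermEq.id_comp f)
  comp_id := by rintro a b ⟨f⟩; exact Quotient.sound (TermEq.comp_id f)
  assoc := by rintro a b c d ⟨f⟩ ⟨g⟩ ⟨h⟩; exact Quotient.sound (TermEq.assoc f g h)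

/-- The morphism represented by a term. -/
def ofTerm {a b : List S.E₁} (f : S.Term a b) : (⟨a⟩ : S.FreeCat) ⟶ ⟨b⟩ := Quotient.mk _ f

theorem eqToHom_eq {a b : S.FreeCat} (h : a = b) :
    eqToHom h = ofTerm (Term.ofEq (congrArg word h)) := by
  subst h; rfl

/-- Concatenation of words and tensor product of (classes of) terms. -/
def strictTensor : StrictTensor S.FreeCat where
  unit := ⟨[]⟩
  obj a b := ⟨a.word ++ b.word⟩
  assoc_obj _ _ _ := congrArg mk (List.append_assoc _ _ _)
  unit_obj _ := congrArg mk (List.nil_append _)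
  obj_unit _ := congrArg mk (List.append_nil _)
  hom f g := Quotient.map₂ Term.tensor (fun _ _ h _ _ h' => TermEq.tensor_congr h h') f g
  hom_id a b := Quotient.sound (TermEq.tensor_id a.word b.word)
  hom_comp := by
    rintro _ _ _ _ _ _ ⟨f⟩ ⟨f'⟩ ⟨g⟩ ⟨g'⟩; exact Quotient.sound (TermEq.interchange f f' g g')
  assoc_hom := by
    rintro _ _ _ _ _ _ ⟨f⟩ ⟨f'⟩ ⟨f''⟩
    rw [eqToHom_eq, eqToHom_eq]
    exact Quotient.sound (TermEq.tensor_assoc f f' f'')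
  unit_hom := by
    rintro _ _ ⟨f⟩
    rw [eqToHom_eq, eqToHom_eq]
    exact Quotient.sound (TermEq.unit_tensor f)
  hom_unit := by
    rintro _ _ ⟨f⟩
    rw [eqToHom_eq, eqToHom_eq]
    exact Quotient.sound (TermEq.tensor_unit f)

instance monoidalCategory : MonoidalCategory S.FreeCat := strictTensor.monoidalCategory

instance strictMonoidal : StrictMonoidal S.FreeCat := strictTensor.strictMonoidal

end Signature.FreeCat

/-- A generator, as a morphism of the free strict monoidal category. -/
def Signature.gen (S : Signature.{u, v}) (x : S.E₂) : (⟨S.s₁ x⟩ : S.FreeCat) ⟶ ⟨S.t₁ x⟩ :=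
  Signature.FreeCat.ofTerm (Signature.Term.gen x)

/-! ### Monoidal equational theories and the categories they generate -/

/-- A monoidal equational theory: a signature together with a set `E₃` of relations, each being a
pair of parallel morphisms of the free strict monoidal category on the signature. -/
structure EqTheory extends Signature.{u, v} where
  E₃ : Type w
  src : E₃ → toSignature.FreeCat
  tgt : E₃ → toSignature.FreeCat
  s₂ : ∀ e : E₃, src e ⟶ tgt e
  t₂ : ∀ e : E₃, src e ⟶ tgt e

namespace EqTheory

/-- The smallest congruence, with respect to composition and tensor product, that contains the
relations of the theory. -/
inductive Congruence (E : EqTheory.{u, v, w}) :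
    ∀ {a b : E.toSignature.FreeCat}, (a ⟶ b) → (a ⟶ b) → Prop
  | rel (e : E.E₃) : Congruence E (E.s₂ e) (E.t₂ e)
  | refl {a b : E.toSignature.FreeCat} (f : a ⟶ b) : Congruence E f f
  | symm {a b : E.toSignature.FreeCat} {f g : a ⟶ b} : Congruence E f g → Congruence E g f
  | trans {a b : E.toSignature.FreeCat} {f g h : a ⟶ b} :
      Congruence E f g → Congruence E g h → Congruence E f h
  | comp {a b c : E.toSignature.FreeCat} {f f' : a ⟶ b} {g g' : b ⟶ c} :
      Congruence E f f' → Congruence E g g' → Congruence E (f ≫ g) (f' ≫ g')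
  | tensor {a b c d : E.toSignature.FreeCat} {f f' : a ⟶ b} {g g' : c ⟶ d} :
      Congruence E f f' → Congruence E g g' → Congruence E (f ⊗ₘ g) (f' ⊗ₘ g')

/-- The setoid of morphisms modulo the relations of the theory. -/
def homSetoid (E : EqTheory.{u, v, w}) (a b : E.toSignature.FreeCat) : Setoid (a ⟶ b) where
  r := Congruence E
  iseqv := ⟨.refl, .symm, .trans⟩

/-- The objects of the category generated by a theory are those of the free strict monoidal
category on its signature. -/
structure Cat (E : EqTheory.{u, v, w}) : Type u where
  as : E.toSignature.FreeCat

namespace Cat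

variable {E : EqTheory.{u, v, w}}

instance category : Category.{max u v} E.Cat where
  Hom a b := Quotient (E.homSetoid a.as b.as)
  id a := Quotient.mk _ (𝟙 a.as)
  comp f g := Quotient.map₂ (fun f g => f ≫ g) (fun _ _ h _ _ h' => Congruence.comp h h') f g
  id_comp := by rintro a b ⟨f⟩; exact congrArg (Quotient.mk _) (Category.id_comp f)
  comp_id := by rintro a b ⟨f⟩; exact congrArg (Quotient.mk _) (Category.comp_id f)
  assoc := by
    rintro a b c d ⟨f⟩ ⟨g⟩ ⟨h⟩; exact congrArg (Quotient.mk _) (Category.assoc f g h)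

/-- The class of a morphism modulo the relations of the theory. -/
def ofHom {a b : E.toSignature.FreeCat} (f : a ⟶ b) : (⟨a⟩ : E.Cat) ⟶ ⟨b⟩ := Quotient.mk _ f

theorem eqToHom_eq {a b : E.Cat} (h : a = b) :
    eqToHom h = ofHom (eqToHom (congrArg as h)) := by
  subst h; rfl

/-- The tensor product induced on the quotient. -/
def strictTensor : StrictTensor E.Cat where
  unit := ⟨𝟙_ E.toSignature.FreeCat⟩
  obj a b := ⟨a.as ⊗ b.as⟩
  assoc_obj _ _ _ := congrArg mk (StrictMonoidal.assoc_obj _ _ _)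
  unit_obj _ := congrArg mk (StrictMonoidal.unit_obj _)
  obj_unit _ := congrArg mk (StrictMonoidal.obj_unit _)
  hom f g := Quotient.map₂ (fun f g => f ⊗ₘ g) (fun _ _ h _ _ h' => Congruence.tensor h h') f g
  hom_id a b := congrArg (Quotient.mk _) (Signature.FreeCat.strictTensor.hom_id a.as b.as)
  hom_comp := by
    rintro _ _ _ _ _ _ ⟨f⟩ ⟨f'⟩ ⟨g⟩ ⟨g'⟩
    exact congrArg (Quotient.mk _) (Signature.FreeCat.strictTensor.hom_comp f f' g g')
  assoc_hom := by
    rintro _ _ _ _ _ _ ⟨f⟩ ⟨f'⟩ ⟨f''⟩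
    rw [eqToHom_eq, eqToHom_eq]
    exact congrArg (Quotient.mk _) (Signature.FreeCat.strictTensor.assoc_hom f f' f'')
  unit_hom := by
    rintro _ _ ⟨f⟩
    rw [eqToHom_eq, eqToHom_eq]
    exact congrArg (Quotient.mk _) (Signature.FreeCat.strictTensor.unit_hom f)
  hom_unit := by
    rintro _ _ ⟨f⟩
    rw [eqToHom_eq, eqToHom_eq]
    exact congrArg (Quotient.mk _) (Signature.FreeCat.strictTensor.hom_unit f)

instance monoidalCategory : MonoidalCategory E.Cat := strictTensor.monoidalCategory

instance strictMonoidal : StrictMonoidal E.Cat := strictTensor.strictMonoidal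

/-- The class of a generator modulo the relations of the theory. -/
def gen (E : EqTheory.{u, v, w}) (x : E.E₂) : (⟨⟨E.s₁ x⟩⟩ : E.Cat) ⟶ ⟨⟨E.t₁ x⟩⟩ :=
  ofHom (E.toSignature.gen x)

end Cat

/-- A theory is a presentation of a strict monoidal category `M` when `M` is monoidally equivalent
to the category generated by the theory. -/
def IsPresentation (E : EqTheory.{u, v, w}) (M : Type u₁) [Category.{v₁} M] [MonoidalCategory M]
    [StrictMonoidal M] : Prop :=
  MonoidallyEquivalent M E.Cat

end EqTheory

/-! ### The theory of bicommutative bialgebras -/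

namespace Bialg

/-- The generators for morphisms. -/
inductive Gen : Type
  | mu | eta | delta | eps | gam

/-- The word of length `n` on the only generator for objects. -/
abbrev ob (n : ℕ) : List Unit := List.replicate n ()

/-- The signature: one generator for objects, and
`μ : 2 → 1`, `η : 0 → 1`, `δ : 1 → 2`, `ε : 1 → 0`, `γ : 2 → 2`. -/
abbrev sig : Signature.{0, 0} where
  E₁ := Unit
  E₂ := Gen
  s₁ x := match x with
    | .mu => ob 2 | .eta => ob 0 | .delta => ob 1 | .eps => ob 1 | .gam => ob 2
  t₁ x := match x with
    | .mu => ob 1 | .eta => ob 1 | .delta => ob 2 | .eps => ob 0 | .gam => ob 2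

/-- The free strict monoidal category on the signature of bialgebras. -/
abbrev Syn : Type := sig.FreeCat

/-- The object `n` of the syntactic category. -/
abbrev N (n : ℕ) : Syn := ⟨ob n⟩

/-- The identity of the object `1`. -/
abbrev I : N 1 ⟶ N 1 := 𝟙 (N 1)
abbrev μ : N 2 ⟶ N 1 := sig.gen .mu
abbrev η : N 0 ⟶ N 1 := sig.gen .eta
abbrev δ : N 1 ⟶ N 2 := sig.gen .delta
abbrev ε : N 1 ⟶ N 0 := sig.gen .eps
abbrev γ : N 2 ⟶ N 2 := sig.gen .gam

/-- The morphisms `id₁ ⊗ γ`, `γ ⊗ id₁` and `id₁ ⊗ γ ⊗ id₁`. -/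
abbrev Iγ : N 3 ⟶ N 3 := I ⊗ₘ γ
abbrev γI : N 3 ⟶ N 3 := γ ⊗ₘ I
abbrev IγI : N 4 ⟶ N 4 := Iγ ⊗ₘ I

/-- Names of the twenty-two relations. -/
inductive Rel : Type
  | yangBaxter | symSym
  | mulAssoc | unitMul | mulUnit | mulNatL | mulNatR | unitNatL | unitNatR | mulComm
  | comulCoassoc | counitComul | comulCounit | comulNatL | comulNatR | counitNatL | counitNatR
  | comulComm
  | mulComul | unitComul | mulCounit | unitCounit

/-- The source of the two sides of a relation. -/
abbrev relSrc : Rel → ℕ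
  | .yangBaxter => 3 | .symSym => 2
  | .mulAssoc => 3 | .unitMul => 1 | .mulUnit => 1 | .mulNatL => 3 | .mulNatR => 3
  | .unitNatL => 1 | .unitNatR => 1 | .mulComm => 2
  | .comulCoassoc => 1 | .counitComul => 1 | .comulCounit => 1 | .comulNatL => 2 | .comulNatR => 2
  | .counitNatL => 2 | .counitNatR => 2 | .comulComm => 1
  | .mulComul => 2 | .unitComul => 0 | .mulCounit => 2 | .unitCounit => 0

/-- The target of the two sides of a relation. -/
abbrev relTgt : Rel → ℕ
  | .yangBaxter => 3 | .symSym => 2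
  | .mulAssoc => 1 | .unitMul => 1 | .mulUnit => 1 | .mulNatL => 2 | .mulNatR => 2
  | .unitNatL => 2 | .unitNatR => 2 | .mulComm => 1
  | .comulCoassoc => 3 | .counitComul => 1 | .comulCounit => 1 | .comulNatL => 3 | .comulNatR => 3
  | .counitNatL => 1 | .counitNatR => 1 | .comulComm => 2
  | .mulComul => 2 | .unitComul => 2 | .mulCounit => 0 | .unitCounit => 0

/-- The two sides of each relation. -/
def sides : ∀ r : Rel, (N (relSrc r) ⟶ N (relTgt r)) × (N (relSrc r) ⟶ N (relTgt r))
  -- symmetry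
  | .yangBaxter => (Iγ ≫ γI ≫ Iγ, γI ≫ Iγ ≫ γI)
  | .symSym => (γ ≫ γ, 𝟙 (N 2))
  -- commutative monoid
  | .mulAssoc => ((μ ⊗ₘ I) ≫ μ, (I ⊗ₘ μ) ≫ μ)
  | .unitMul => ((η ⊗ₘ I) ≫ μ, I)
  | .mulUnit => ((I ⊗ₘ η) ≫ μ, I)
  | .mulNatL => ((μ ⊗ₘ I) ≫ γ, Iγ ≫ γI ≫ (I ⊗ₘ μ))
  | .mulNatR => ((I ⊗ₘ μ) ≫ γ, γI ≫ Iγ ≫ (μ ⊗ₘ I))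
  | .unitNatL => ((η ⊗ₘ I) ≫ γ, I ⊗ₘ η)
  | .unitNatR => ((I ⊗ₘ η) ≫ γ, η ⊗ₘ I)
  | .mulComm => (γ ≫ μ, μ)
  -- cocommutative comonoid
  | .comulCoassoc => (δ ≫ (δ ⊗ₘ I), δ ≫ (I ⊗ₘ δ))
  | .counitComul => (δ ≫ (ε ⊗ₘ I), I)
  | .comulCounit => (δ ≫ (I ⊗ₘ ε), I)
  | .comulNatL => (γ ≫ (δ ⊗ₘ I), (I ⊗ₘ δ) ≫ γI ≫ Iγ)
  | .comulNatR => (γ ≫ (I ⊗ₘ δ), (δ ⊗ₘ I) ≫ Iγ ≫ γI)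
  | .counitNatL => (γ ≫ (ε ⊗ₘ I), I ⊗ₘ ε)
  | .counitNatR => (γ ≫ (I ⊗ₘ ε), ε ⊗ₘ I)
  | .comulComm => (δ ≫ γ, δ)
  -- compatibility of the two structures
  | .mulComul => (μ ≫ δ, (δ ⊗ₘ δ) ≫ IγI ≫ (μ ⊗ₘ μ))
  | .unitComul => (η ≫ δ, η ⊗ₘ η)
  | .mulCounit => (μ ≫ ε, ε ⊗ₘ ε)
  | .unitCounit => (η ≫ ε, 𝟙 (N 0))

/-- The equational theory of bicommutative bialgebras. -/
abbrev theory : EqTheory.{0, 0, 0} where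
  toSignature := sig
  E₃ := Rel
  src r := N (relSrc r)
  tgt r := N (relTgt r)
  s₂ r := (sides r).1
  t₂ r := (sides r).2

end Bialg

/-! ### Multirelations -/

/-- The objects of the category of multirelations are the finite ordinals. -/
structure MRel : Type where
  of ::
  card : ℕ

namespace MRel

/-- A morphism `m ⟶ n` is a multirelation `Fin m → Fin n → ℕ`; the composite of `R₁` and `R₂` is
`(a, c) ↦ ∑ b, R₁ a b * R₂ b c`. -/
instance category : Category.{0} MRel where
  Hom m n := Matrix (Fin m.card) (Fin n.card) ℕ
  id m := (1 : Matrix (Fin m.card) (Fin m.card) ℕ)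
  comp {m n p} (R₁ : Matrix (Fin m.card) (Fin n.card) ℕ)
    (R₂ : Matrix (Fin n.card) (Fin p.card) ℕ) := R₁ * R₂
  id_comp R := Matrix.one_mul R
  comp_id R := Matrix.mul_one R
  assoc R₁ R₂ R₃ := Matrix.mul_assoc R₁ R₂ R₃

/-- A matrix with natural number coefficients, as a multirelation. -/
abbrev ofMatrix {m n : ℕ} (R : Matrix (Fin m) (Fin n) ℕ) : of m ⟶ of n := R

/-- The coefficients of a multirelation. -/
abbrev coeff {m n : MRel} (R : m ⟶ n) : Matrix (Fin m.card) (Fin n.card) ℕ := R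

/-- The disjoint union of two multirelations. -/
def sum {m n p q : ℕ} (R : Matrix (Fin m) (Fin n) ℕ) (R' : Matrix (Fin p) (Fin q) ℕ) :
    Matrix (Fin (m + p)) (Fin (n + q)) ℕ :=
  Matrix.reindex finSumFinEquiv finSumFinEquiv (Matrix.fromBlocks R 0 0 R')

theorem coeff_comp_eqToHom {m n p : MRel} (R : m ⟶ n) (h : n = p) (i : Fin m.card)
    (j : Fin p.card) :
    coeff (R ≫ eqToHom h) i j = coeff R i (Fin.cast (congrArg card h.symm) j) := by
  subst h
  exact congrFun (congrFun (Matrix.mul_one R) i) j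

theorem coeff_eqToHom_comp {m n p : MRel} (R : n ⟶ p) (h : m = n) (i : Fin m.card)
    (j : Fin p.card) :
    coeff (eqToHom h ≫ R) i j = coeff R (Fin.cast (congrArg card h) i) j := by
  subst h
  exact congrFun (congrFun (Matrix.one_mul R) i) j

theorem sum_one_one (m n : ℕ) :
    sum (1 : Matrix (Fin m) (Fin m) ℕ) (1 : Matrix (Fin n) (Fin n) ℕ) = 1 := by
  simp [sum]

theorem sum_mul_sum {m n p m' n' p' : ℕ} (R : Matrix (Fin m) (Fin n) ℕ)
    (R' : Matrix (Fin m') (Fin n') ℕ) (Q : Matrix (Fin n) (Fin p) ℕ)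
    (Q' : Matrix (Fin n') (Fin p') ℕ) : sum R R' * sum Q Q' = sum (R * Q) (R' * Q') := by
  simp [sum, Matrix.submatrix_mul_equiv, Matrix.fromBlocks_multiply]

section

variable {m n p q : ℕ} (R : Matrix (Fin m) (Fin n) ℕ) (R' : Matrix (Fin p) (Fin q) ℕ)

theorem sum_inl_inl (i : Fin m) (j : Fin n) :
    sum R R' (Fin.castAdd p i) (Fin.castAdd q j) = R i j := by
  simp [sum]

theorem sum_inl_inr (i : Fin m) (j : Fin q) :
    sum R R' (Fin.castAdd p i) (Fin.natAdd n j) = 0 := by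
  simp [sum]

theorem sum_inr_inl (i : Fin p) (j : Fin n) :
    sum R R' (Fin.natAdd m i) (Fin.castAdd q j) = 0 := by
  simp [sum]

theorem sum_inr_inr (i : Fin p) (j : Fin q) :
    sum R R' (Fin.natAdd m i) (Fin.natAdd n j) = R' i j := by
  simp [sum]

end

theorem sum_assoc_apply {m n m' n' m'' n'' : ℕ} (R : Matrix (Fin m) (Fin n) ℕ)
    (R' : Matrix (Fin m') (Fin n') ℕ) (R'' : Matrix (Fin m'') (Fin n'') ℕ)
    (i : Fin (m + m' + m'')) (j : Fin (n + (n' + n''))) :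
    sum (sum R R') R'' i (Fin.cast (Nat.add_assoc n n' n'').symm j) =
      sum R (sum R' R'') (Fin.cast (Nat.add_assoc m m' m'') i) j := by
  have c₁ (a b c : ℕ) (k : Fin a) : Fin.cast (Nat.add_assoc a b c)
      (Fin.castAdd c (Fin.castAdd b k)) = Fin.castAdd (b + c) k := by ext; simp
  have c₂ (a b c : ℕ) (k : Fin b) : Fin.cast (Nat.add_assoc a b c)
      (Fin.castAdd c (Fin.natAdd a k)) = Fin.natAdd a (Fin.castAdd c k) := by ext; simp
  have c₃ (a b c : ℕ) (k : Fin c) : Fin.cast (Nat.add_assoc a b c)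
      (Fin.natAdd (a + b) k) = Fin.natAdd a (Fin.natAdd b k) := by ext; simp [Nat.add_assoc]
  obtain ⟨j, rfl⟩ : ∃ k, j = Fin.cast (Nat.add_assoc n n' n'') k := ⟨Fin.cast (by omega) j, rfl⟩
  rw [show Fin.cast (Nat.add_assoc n n' n'').symm (Fin.cast (Nat.add_assoc n n' n'') j) = j from rfl]
  refine Fin.addCases (fun i => Fin.addCases (fun i => ?_) (fun i => ?_) i) (fun i => ?_) i <;>
  refine Fin.addCases (fun j => Fin.addCases (fun j => ?_) (fun j => ?_) j) (fun j => ?_) j <;>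
  simp only [c₁, c₂, c₃, sum_inl_inl, sum_inl_inr, sum_inr_inl, sum_inr_inr]

theorem sum_zero_left_apply {m n : ℕ} (R : Matrix (Fin m) (Fin n) ℕ) (i : Fin (0 + m))
    (j : Fin n) :
    sum (1 : Matrix (Fin 0) (Fin 0) ℕ) R i (Fin.cast (Nat.zero_add n).symm j) =
      R (Fin.cast (Nat.zero_add m) i) j := by
  have hi : i = Fin.natAdd 0 (Fin.cast (Nat.zero_add m) i) := by ext; simp
  have hj : Fin.cast (Nat.zero_add n).symm j = Fin.natAdd 0 j := by ext; simp
  conv_lhs => rw [hj, hi]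
  exact sum_inr_inr _ _ _ _

theorem sum_zero_right_apply {m n : ℕ} (R : Matrix (Fin m) (Fin n) ℕ) (i : Fin (m + 0))
    (j : Fin n) :
    sum R (1 : Matrix (Fin 0) (Fin 0) ℕ) i (Fin.cast (Nat.add_zero n).symm j) =
      R (Fin.cast (Nat.add_zero m) i) j :=
  sum_inl_inl R (1 : Matrix (Fin 0) (Fin 0) ℕ) i j

/-- The tensor product, given on objects and morphisms by disjoint union. -/
def strictTensor : StrictTensor MRel where
  unit := of 0
  obj m n := of (m.card + n.card)
  assoc_obj _ _ _ := congrArg of (Nat.add_assoc _ _ _)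
  unit_obj _ := congrArg of (Nat.zero_add _)
  obj_unit _ := congrArg of (Nat.add_zero _)
  hom R R' := sum R R'
  hom_id m n := sum_one_one m.card n.card
  hom_comp R R' Q Q' := sum_mul_sum R R' Q Q'
  assoc_hom R R' R'' := by
    refine Matrix.ext fun i j => ?_
    exact (coeff_comp_eqToHom _ _ i j).trans
      ((sum_assoc_apply R R' R'' i j).trans (coeff_eqToHom_comp _ _ i j).symm)
  unit_hom R := by
    refine Matrix.ext fun i j => ?_
    exact (coeff_comp_eqToHom _ _ i j).trans
      ((sum_zero_left_apply R i j).trans (coeff_eqToHom_comp _ _ i j).symm)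
  hom_unit R := by
    refine Matrix.ext fun i j => ?_
    exact (coeff_comp_eqToHom _ _ i j).trans
      ((sum_zero_right_apply R i j).trans (coeff_eqToHom_comp _ _ i j).symm)

instance monoidalCategory : MonoidalCategory MRel := strictTensor.monoidalCategory

instance strictMonoidal : StrictMonoidal MRel := strictTensor.strictMonoidal

/-- The multirelations that make the object `1` a bicommutative bialgebra. -/
def interpGen : ∀ x : Bialg.Gen,
    of (Bialg.theory.s₁ x).length ⟶ of (Bialg.theory.t₁ x).length
  | .mu => ofMatrix !![1; 1]
  | .eta => ofMatrix (0 : Matrix (Fin 0) (Fin 1) ℕ)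
  | .delta => ofMatrix !![1, 1]
  | .eps => ofMatrix (0 : Matrix (Fin 1) (Fin 0) ℕ)
  | .gam => ofMatrix !![0, 1; 1, 0]

end MRel

/-- A functor from the category generated by the theory of bicommutative bialgebras to multirelations
is the interpretation functor when it is strict monoidal, sends a word to its length (in particular
`1` to `1`) and sends the generators to the multirelations `MRel.interpGen`. -/
structure IsInterpretation (F : Bialg.theory.Cat ⥤ MRel) : Prop where
  strict : IsStrictMonoidal F
  obj : ∀ X, F.obj X = MRel.of X.as.word.length
  map_gen : ∀ x : Bialg.Gen, F.map (EqTheory.Cat.gen Bialg.theory x) =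
    eqToHom (obj _) ≫ MRel.interpGen x ≫ eqToHom (obj _).symm

/-! Every morphism equals a normal form read off its matrix. Read a morphism as a linear map on row
vectors. For a row `r` of length `n`, the morphism `absorb` : `1 + n ⟶ n` acts as `(c, v) ↦ v + c
r`. The normal form of a matrix starts from a tensor power of `η` (the zero vector) and absorbs the
input wires one at a time, each with its own row.

The key point is that every syntactic morphism `f` is provably linear from the relations alone: `f
(v + c r) = f v + c (f r)` and `f 0 = 0`, where `f r` is computed with the matrix of `f`. This is
the predicate `Slides`. It holds for the generators, by identities about the two-wire morphisms
`pass k`, and is stable under composition and tensor product, hence holds for all morphisms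
(`Slides.of_hom`). So composing the normal form of `R` with `f` gives the normal form of the product
of `R` with the matrix of `f` (`normalForm_comp`). As the normal form of the identity matrix is the
identity (`normalForm_one`), each `f` is the normal form of its own matrix, so the interpretation is
faithful. It is full because the normal form of `R` is interpreted by `R` (`map_normalForm`). Words
over one letter are determined by their length, so the functor is bijective on objects, and its
inverse is strict monoidal.

To avoid bookkeeping with associativity, the relations are used only through the endofunctor `1 ⊗
-`: each generator, tensored with an arbitrary object on its right, is a natural transformation
between iterates of it. -/

/-! ### Bialgebras acting on a category -/

/-- An endofunctor with a bicommutative bialgebra structure for the composition of endofunctors: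
the action of a bicommutative bialgebra on a category. -/
structure BialgebraAction (K : Type u) [Category.{v} K] where
  T : K ⥤ K
  mul : T ⋙ T ⟶ T
  one : 𝟭 K ⟶ T
  comul : T ⟶ T ⋙ T
  counit : T ⟶ 𝟭 K
  swap : T ⋙ T ⟶ T ⋙ T
  swap_swap X : swap.app X ≫ swap.app X = 𝟙 _
  yangBaxter X : T.map (swap.app X) ≫ swap.app (T.obj X) ≫ T.map (swap.app X) =
    swap.app (T.obj X) ≫ T.map (swap.app X) ≫ swap.app (T.obj X)
  mul_assoc X : mul.app (T.obj X) ≫ mul.app X = T.map (mul.app X) ≫ mul.app X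
  one_mul X : one.app (T.obj X) ≫ mul.app X = 𝟙 _
  mul_one X : T.map (one.app X) ≫ mul.app X = 𝟙 _
  mul_swap X : mul.app (T.obj X) ≫ swap.app X =
    T.map (swap.app X) ≫ swap.app (T.obj X) ≫ T.map (mul.app X)
  map_mul_swap X : T.map (mul.app X) ≫ swap.app X =
    swap.app (T.obj X) ≫ T.map (swap.app X) ≫ mul.app (T.obj X)
  map_one_swap X : T.map (one.app X) ≫ swap.app X = one.app (T.obj X)
  swap_mul X : swap.app X ≫ mul.app X = mul.app X
  comul_assoc X : comul.app X ≫ comul.app (T.obj X) = comul.app X ≫ T.map (comul.app X)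
  comul_counit X : comul.app X ≫ counit.app (T.obj X) = 𝟙 _
  comul_map_counit X : comul.app X ≫ T.map (counit.app X) = 𝟙 _
  swap_comul X : swap.app X ≫ comul.app (T.obj X) =
    T.map (comul.app X) ≫ swap.app (T.obj X) ≫ T.map (swap.app X)
  swap_map_comul X : swap.app X ≫ T.map (comul.app X) =
    comul.app (T.obj X) ≫ T.map (swap.app X) ≫ swap.app (T.obj X)
  swap_counit X : swap.app X ≫ counit.app (T.obj X) = T.map (counit.app X)
  swap_map_counit X : swap.app X ≫ T.map (counit.app X) = counit.app (T.obj X)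
  comul_swap X : comul.app X ≫ swap.app X = comul.app X
  mul_comul X : mul.app X ≫ comul.app X =
    comul.app (T.obj X) ≫ T.map (T.map (comul.app X)) ≫ T.map (swap.app (T.obj X)) ≫
      mul.app (T.obj (T.obj X)) ≫ T.map (mul.app X)
  one_comul X : one.app X ≫ comul.app X = one.app X ≫ T.map (one.app X)
  mul_counit X : mul.app X ≫ counit.app X = counit.app (T.obj X) ≫ counit.app X
  one_counit X : one.app X ≫ counit.app X = 𝟙 _

namespace BialgebraAction

variable {K : Type u} [Category.{v} K] (B : BialgebraAction K)

theorem map_map_mul {X Y : K} (f : X ⟶ Y) :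
    B.T.map (B.T.map f) ≫ B.mul.app Y = B.mul.app X ≫ B.T.map f := B.mul.naturality f

theorem map_comul {X Y : K} (f : X ⟶ Y) :
    B.T.map f ≫ B.comul.app Y = B.comul.app X ≫ B.T.map (B.T.map f) := B.comul.naturality f

theorem map_map_swap {X Y : K} (f : X ⟶ Y) :
    B.T.map (B.T.map f) ≫ B.swap.app Y = B.swap.app X ≫ B.T.map (B.T.map f) :=
  B.swap.naturality f

theorem map_counit {X Y : K} (f : X ⟶ Y) :
    B.T.map f ≫ B.counit.app Y = B.counit.app X ≫ f := B.counit.naturality f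

theorem comp_one {X Y : K} (f : X ⟶ Y) :
    f ≫ B.one.app Y = B.one.app X ≫ B.T.map f := B.one.naturality f

/-! ### Crossings with a multiplicity -/

/-- On two wires, `pass k` is `(x, y) ↦ (y + k x, x)`. -/
def pass : ℕ → ∀ X : K, B.T.obj (B.T.obj X) ⟶ B.T.obj (B.T.obj X)
  | 0, X => B.swap.app X
  | k + 1, X => B.comul.app (B.T.obj X) ≫ B.T.map (pass k X) ≫ B.mul.app (B.T.obj X)

theorem map_map_pass (k : ℕ) {X Y : K} (f : X ⟶ Y) :
    B.T.map (B.T.map f) ≫ B.pass k Y = B.pass k X ≫ B.T.map (B.T.map f) := by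
  induction k with
  | zero => exact B.map_map_swap f
  | succ k ih =>
    have ih' := congrArg B.T.map ih
    simp only [Functor.map_comp] at ih'
    simp only [pass, Category.assoc]
    rw [reassoc_of% B.map_comul, reassoc_of% ih', B.map_map_mul]

/-- Discarding `y + k x` discards `y` and every copy of `x` added to it, because `ε` is
multiplicative and the copies are removed by the counit law. -/
theorem pass_counit (k : ℕ) (X : K) :
    B.pass k X ≫ B.counit.app (B.T.obj X) = B.T.map (B.counit.app X) := by
  induction k with
  | zero => exact B.swap_counit X
  | succ k ih =>
    have ih' := congrArg B.T.map ih
    simp only [Functor.map_comp] at ih'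
    have n := B.map_counit (Y := B.T.obj X) (B.counit.app (B.T.obj X))
    simp only [pass, Category.assoc]
    rw [B.mul_counit, ← n, reassoc_of% ih', B.map_counit (Y := B.T.obj X),
      reassoc_of% B.comul_counit]

/-- Both sides are `(x, y) ↦ (y + k x, x, x)`. They differ in which copies of `x` are added to `y`,
which coassociativity and cocommutativity make irrelevant. -/
theorem pass_map_comul (k : ℕ) (X : K) :
    B.pass k X ≫ B.T.map (B.comul.app X) =
      B.comul.app (B.T.obj X) ≫ B.T.map (B.pass k X) ≫ B.swap.app (B.T.obj X) := by
  induction k with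
  | zero => exact B.swap_map_comul X
  | succ k ih =>
    have ih' := congrArg B.T.map ih
    simp only [Functor.map_comp] at ih'
    simp only [pass, Functor.map_comp, Category.assoc]
    rw [← B.map_map_mul, reassoc_of% ih', B.map_mul_swap, reassoc_of% B.map_map_swap,
      ← reassoc_of% B.comul_assoc, ← reassoc_of% B.comul_assoc, reassoc_of% B.comul_swap]
    rfl

/-- Both sides are `(x, y) ↦ (y + k x, y + k x, x)`. Copying a sum is where the bialgebra law
`mul_comul` enters. -/
theorem pass_comul (k : ℕ) (X : K) :
    B.pass k X ≫ B.comul.app (B.T.obj X) =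
      B.T.map (B.comul.app X) ≫ B.pass k (B.T.obj X) ≫ B.T.map (B.pass k X) := by
  induction k with
  | zero => exact B.swap_comul X
  | succ k ih =>
    have ih' := congrArg (fun f => B.T.map (B.T.map f)) ih
    have h := congrArg B.T.map (B.pass_map_comul k (B.T.obj X))
    have h' := congrArg B.T.map (B.map_map_swap (B.pass k X))
    have n₁ := B.map_comul (Y := B.T.obj (B.T.obj X)) (B.comul.app X)
    have n₂ := B.map_comul (Y := B.T.obj (B.T.obj (B.T.obj X))) (B.T.map (B.comul.app X))
    simp only [Functor.map_comp] at ih' h h'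
    simp only [pass, Functor.map_comp, Category.assoc]
    rw [← reassoc_of% B.map_map_mul, reassoc_of% h, B.mul_comul, reassoc_of% B.map_comul,
      reassoc_of% ih', reassoc_of% h', ← reassoc_of% B.map_map_mul, ← reassoc_of% B.comul_assoc,
      reassoc_of% n₁, reassoc_of% n₂]

theorem pass_zero_pass_mul (l : ℕ) (X : K) :
    B.swap.app (B.T.obj X) ≫ B.T.map (B.pass l X) ≫ B.mul.app (B.T.obj X) =
      B.T.map (B.mul.app X) ≫ B.pass l X := by
  induction l with
  | zero => exact (B.map_mul_swap X).symm
  | succ l ih =>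
    have ih' := congrArg B.T.map ih
    simp only [Functor.map_comp] at ih'
    simp only [pass, Functor.map_comp, Category.assoc]
    rw [← B.mul_assoc, reassoc_of% B.swap_map_comul, ← reassoc_of% B.map_map_swap,
      reassoc_of% B.swap_mul, B.mul_assoc, reassoc_of% ih', ← reassoc_of% B.map_comul]

/-- Both sides are `(x, y, z) ↦ (y + z + (k + l) x, x)`. Associativity moves one copy of `x` at a
time out of the first `pass`; the case `k = 0`, proved by induction on `l`, uses commutativity of
`μ`. -/
theorem pass_pass_mul (k l : ℕ) (X : K) :
    B.pass k (B.T.obj X) ≫ B.T.map (B.pass l X) ≫ B.mul.app (B.T.obj X) =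
      B.T.map (B.mul.app X) ≫ B.pass (k + l) X := by
  induction k with
  | zero => rw [Nat.zero_add]; exact B.pass_zero_pass_mul l X
  | succ k ih =>
    have ih' := congrArg B.T.map ih
    simp only [Functor.map_comp] at ih'
    rw [Nat.succ_add]
    simp only [pass, Category.assoc]
    rw [← reassoc_of% B.map_map_mul, B.mul_assoc, reassoc_of% ih', ← reassoc_of% B.map_comul]

theorem swap_pass_swap (l : ℕ) (X : K) :
    B.swap.app (B.T.obj X) ≫ B.T.map (B.pass l X) ≫ B.swap.app (B.T.obj X) =
      B.T.map (B.swap.app X) ≫ B.pass l (B.T.obj X) ≫ B.T.map (B.swap.app X) := by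
  induction l with
  | zero => exact (B.yangBaxter X).symm
  | succ l ih =>
    have ih' := congrArg B.T.map ih
    simp only [Functor.map_comp] at ih'
    simp only [pass, Functor.map_comp, Category.assoc]
    rw [B.map_mul_swap, reassoc_of% B.swap_map_comul, ← reassoc_of% B.map_map_swap,
      reassoc_of% B.swap_swap, reassoc_of% ih', ← reassoc_of% B.map_comul, B.map_map_mul]

/-- Both sides are `(x, y, z) ↦ (z + l x, y + k x, x)`: a Yang–Baxter equation with multiplicities,
obtained from the plain one by induction on `l` and then on `k`. -/
theorem pass_pass_swap (k l : ℕ) (X : K) :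
    B.pass k (B.T.obj X) ≫ B.T.map (B.pass l X) ≫ B.swap.app (B.T.obj X) =
      B.T.map (B.swap.app X) ≫ B.pass l (B.T.obj X) ≫ B.T.map (B.pass k X) := by
  induction k with
  | zero => exact B.swap_pass_swap l X
  | succ k ih =>
    have ih' := congrArg B.T.map ih
    simp only [Functor.map_comp] at ih'
    simp only [pass, Functor.map_comp, Category.assoc]
    rw [← reassoc_of% B.map_map_mul, B.mul_swap, reassoc_of% ih',
      ← reassoc_of% B.map_comul, reassoc_of% B.pass_map_comul, reassoc_of% B.map_map_swap]

theorem map_one_pass_one (X : K) :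
    B.T.map (B.one.app X) ≫ B.pass 1 X = B.comul.app X := by
  have h := congrArg B.T.map (B.map_one_swap X)
  simp only [Functor.map_comp] at h
  simp only [pass]
  rw [reassoc_of% B.map_comul, reassoc_of% h, B.mul_one]
  exact Category.comp_id _

/-! Sliding the structure morphisms past `pass k ≫ T.map a`, for `a : T.obj X ⟶ X`. -/

variable {X : K} (a : B.T.obj X ⟶ X)

/-- If `a` absorbs a row `r`, then `pass k X ≫ T.map a` absorbs the row `r` with `k` prepended. The
`slide` lemmas are thus the linearity of the structure morphisms, and the multiplicities on their
right-hand sides record the effect on rows: `μ` adds two entries, `δ` repeats one, `γ` exchanges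
two, `η` inserts `0`, `ε` drops one. -/
theorem slide_map {Y : K} (k : ℕ) (f : X ⟶ Y) (b : B.T.obj Y ⟶ Y) (h : a ≫ f = B.T.map f ≫ b) :
    (B.pass k X ≫ B.T.map a) ≫ B.T.map f = B.T.map (B.T.map f) ≫ B.pass k Y ≫ B.T.map b := by
  rw [Category.assoc, ← Functor.map_comp, h, Functor.map_comp, reassoc_of% B.map_map_pass]

theorem slide_mul (k l : ℕ) :
    (B.pass k (B.T.obj X) ≫ B.T.map (B.pass l X ≫ B.T.map a)) ≫ B.mul.app X =
      B.T.map (B.mul.app X) ≫ B.pass (k + l) X ≫ B.T.map a := by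
  rw [Category.assoc, Functor.map_comp, Category.assoc, B.map_map_mul,
    reassoc_of% B.pass_pass_mul]

theorem slide_swap (k l : ℕ) :
    (B.pass k (B.T.obj X) ≫ B.T.map (B.pass l X ≫ B.T.map a)) ≫ B.swap.app X =
      B.T.map (B.swap.app X) ≫ B.pass l (B.T.obj X) ≫ B.T.map (B.pass k X ≫ B.T.map a) := by
  rw [Category.assoc, Functor.map_comp, Category.assoc, B.map_map_swap,
    reassoc_of% B.pass_pass_swap, Functor.map_comp]

theorem slide_one :
    a ≫ B.one.app X = B.T.map (B.one.app X) ≫ B.pass 0 X ≫ B.T.map a :=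
  (B.comp_one a).trans
    ((congrArg (· ≫ B.T.map a) (B.map_one_swap X)).symm.trans (Category.assoc _ _ _))

theorem slide_comul (k : ℕ) :
    (B.pass k X ≫ B.T.map a) ≫ B.comul.app X =
      B.T.map (B.comul.app X) ≫ B.pass k (B.T.obj X) ≫ B.T.map (B.pass k X ≫ B.T.map a) := by
  rw [Category.assoc, B.map_comul, reassoc_of% B.pass_comul, Functor.map_comp]

theorem slide_counit (k : ℕ) :
    (B.pass k X ≫ B.T.map a) ≫ B.counit.app X = B.T.map (B.counit.app X) ≫ a := by
  rw [Category.assoc, B.map_counit, reassoc_of% B.pass_counit]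

theorem one_one (X : K) :
    B.one.app X ≫ B.one.app (B.T.obj X) = B.one.app X ≫ B.T.map (B.one.app X) :=
  B.comp_one (B.one.app X)

theorem one_one_swap (X : K) :
    (B.one.app X ≫ B.one.app (B.T.obj X)) ≫ B.swap.app X =
      B.one.app X ≫ B.one.app (B.T.obj X) := by
  conv_lhs => rw [one_one, Category.assoc]
  exact congrArg (_ ≫ ·) (B.map_one_swap X)

end BialgebraAction

/-! ### Strictness laws as heterogeneous equalities -/

section HEq

variable {D : Type u₁} [Category.{v₁} D]

theorem eqToHom_comp_comp_eqToHom_heq {W X Y Z : D} (h : W = X) (f : X ⟶ Y) (h' : Y = Z) :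
    HEq (eqToHom h ≫ f ≫ eqToHom h') f := by
  subst h h'; simp

theorem heq_of_comp_eqToHom_eq {W X Y Z : D} {f : W ⟶ X} {g : Y ⟶ Z} (h : X = Z) (h' : W = Y)
    (e : f ≫ eqToHom h = eqToHom h' ≫ g) : HEq f g := by
  subst h h'; simpa using e

theorem comp_eqToHom_eq_of_heq {W X Y Z : D} {f : W ⟶ X} {g : Y ⟶ Z} (h : X = Z) (h' : W = Y)
    (e : HEq f g) : f ≫ eqToHom h = eqToHom h' ≫ g := by
  subst h h'; simpa using e

variable [MonoidalCategory D]

theorem tensorHom_heq {X₁ Y₁ X₂ Y₂ X₁' Y₁' X₂' Y₂' : D} {f : X₁ ⟶ Y₁} {g : X₂ ⟶ Y₂}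
    {f' : X₁' ⟶ Y₁'} {g' : X₂' ⟶ Y₂'} (h₁ : X₁ = X₁') (h₂ : Y₁ = Y₁') (h₃ : X₂ = X₂')
    (h₄ : Y₂ = Y₂') (hf : HEq f f') (hg : HEq g g') : HEq (f ⊗ₘ g) (f' ⊗ₘ g') := by
  subst h₁ h₂ h₃ h₄ hf hg; rfl

variable [StrictMonoidal D]

/-- This is naturality of the associator, whose components are transports along equalities of
objects. -/
theorem tensorHom_assoc_heq {X₁ Y₁ X₂ Y₂ X₃ Y₃ : D} (f : X₁ ⟶ Y₁) (g : X₂ ⟶ Y₂) (h : X₃ ⟶ Y₃) :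
    HEq ((f ⊗ₘ g) ⊗ₘ h) (f ⊗ₘ (g ⊗ₘ h)) := by
  have := associator_naturality f g h
  rw [StrictMonoidal.associator_eq, StrictMonoidal.associator_eq, eqToIso.hom, eqToIso.hom] at this
  exact heq_of_comp_eqToHom_eq _ _ this

theorem id_unit_tensorHom_heq {X Y : D} (f : X ⟶ Y) : HEq (𝟙 (𝟙_ D) ⊗ₘ f) f := by
  have := leftUnitor_naturality f
  rw [StrictMonoidal.leftUnitor_eq, StrictMonoidal.leftUnitor_eq, eqToIso.hom, eqToIso.hom,
    ← id_tensorHom] at this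
  exact heq_of_comp_eqToHom_eq _ _ this

theorem tensorHom_id_unit_heq {X Y : D} (f : X ⟶ Y) : HEq (f ⊗ₘ 𝟙 (𝟙_ D)) f := by
  have := rightUnitor_naturality f
  rw [StrictMonoidal.rightUnitor_eq, StrictMonoidal.rightUnitor_eq, eqToIso.hom, eqToIso.hom,
    ← tensorHom_id] at this
  exact heq_of_comp_eqToHom_eq _ _ this

end HEq

/-! ### Functors out of free and presented categories -/

/-- An interpretation of a signature in a monoidal category. -/
structure Signature.Interp (S : Signature.{u, v}) (D : Type u₁) [Category.{v₁} D]
    [MonoidalCategory D] where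
  obj : List S.E₁ → D
  obj_nil : obj [] = 𝟙_ D
  obj_append : ∀ a b, obj (a ++ b) = obj a ⊗ obj b
  gen : ∀ x, obj (S.s₁ x) ⟶ obj (S.t₁ x)

namespace Signature.Interp

variable {S : Signature.{u, v}} {D : Type u₁} [Category.{v₁} D] [MonoidalCategory D]
  (φ : S.Interp D)

/-- The value of a term. -/
def eval : ∀ {a b : List S.E₁}, S.Term a b → (φ.obj a ⟶ φ.obj b)
  | _, _, .gen x => φ.gen x
  | _, _, .id _ => 𝟙 _
  | _, _, .comp f g => eval f ≫ eval g
  | _, _, .tensor f g =>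
    eqToHom (φ.obj_append _ _) ≫ (eval f ⊗ₘ eval g) ≫ eqToHom (φ.obj_append _ _).symm

theorem eval_ofEq {a b : List S.E₁} (h : a = b) :
    φ.eval (.ofEq h) = eqToHom (congrArg φ.obj h) := by
  subst h; rfl

theorem eval_tensor_heq {a b c d : List S.E₁} (f : S.Term a b) (g : S.Term c d) :
    HEq (φ.eval (.tensor f g)) (φ.eval f ⊗ₘ φ.eval g) :=
  eqToHom_comp_comp_eqToHom_heq _ _ _

theorem eval_eq [StrictMonoidal D] {a b : List S.E₁} {f g : S.Term a b} (h : S.TermEq f g) :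
    φ.eval f = φ.eval g := by
  induction h with
  | refl f => rfl
  | symm _ ih => exact ih.symm
  | trans _ _ ih₁ ih₂ => exact ih₁.trans ih₂
  | comp_congr _ _ ih₁ ih₂ => simp only [eval, ih₁, ih₂]
  | tensor_congr _ _ ih₁ ih₂ => simp only [eval, ih₁, ih₂]
  | id_comp f => simp [eval]
  | comp_id f => simp [eval]
  | assoc f g h => simp [eval]
  | tensor_id a b => simp [eval]
  | interchange f f' g g' => simp [eval]
  | tensor_assoc f f' f'' =>
    simp only [eval.eq_3, eval_ofEq]
    refine comp_eqToHom_eq_of_heq _ _ ((φ.eval_tensor_heq _ _).trans ?_)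
    refine .trans ?_ (φ.eval_tensor_heq _ _).symm
    refine .trans ?_ ((tensorHom_assoc_heq (φ.eval f) (φ.eval f') (φ.eval f'')).trans ?_)
    · exact tensorHom_heq (φ.obj_append _ _) (φ.obj_append _ _) rfl rfl
        (φ.eval_tensor_heq _ _) .rfl
    · exact tensorHom_heq rfl rfl (φ.obj_append _ _).symm (φ.obj_append _ _).symm .rfl
        (φ.eval_tensor_heq _ _).symm
  | unit_tensor f =>
    simp only [eval.eq_3, eval_ofEq]
    refine comp_eqToHom_eq_of_heq _ _ ((φ.eval_tensor_heq _ _).trans ?_)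
    refine .trans ?_ (id_unit_tensorHom_heq (φ.eval f))
    refine tensorHom_heq φ.obj_nil φ.obj_nil rfl rfl ?_ .rfl
    simp only [eval]; rw [φ.obj_nil]
  | tensor_unit f =>
    simp only [eval.eq_3, eval_ofEq]
    refine comp_eqToHom_eq_of_heq _ _ ((φ.eval_tensor_heq _ _).trans ?_)
    refine .trans ?_ (tensorHom_id_unit_heq (φ.eval f))
    refine tensorHom_heq rfl rfl φ.obj_nil φ.obj_nil .rfl ?_
    simp only [eval]; rw [φ.obj_nil]

variable [StrictMonoidal D]

/-- The functor induced by an interpretation. -/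
def functor : S.FreeCat ⥤ D where
  obj a := φ.obj a.word
  map f := Quotient.lift φ.eval (fun _ _ h => φ.eval_eq h) f
  map_comp := by rintro _ _ _ ⟨f⟩ ⟨g⟩; rfl

theorem functor_isStrictMonoidal : IsStrictMonoidal φ.functor where
  unit_obj := φ.obj_nil
  tensor_obj _ _ := φ.obj_append _ _
  tensor_map := by rintro _ _ _ _ ⟨f⟩ ⟨g⟩; rfl

end Signature.Interp

namespace EqTheory

variable {E : EqTheory.{u, v, w}} {D : Type u₁} [Category.{v₁} D] [MonoidalCategory D]
  {F : E.toSignature.FreeCat ⥤ D}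

theorem map_eq_of_congruence (hF : IsStrictMonoidal F)
    (h : ∀ e, F.map (E.s₂ e) = F.map (E.t₂ e)) {a b : E.toSignature.FreeCat} {f g : a ⟶ b}
    (c : E.Congruence f g) : F.map f = F.map g := by
  induction c with
  | rel e => exact h e
  | refl f => rfl
  | symm _ ih => exact ih.symm
  | trans _ _ ih₁ ih₂ => exact ih₁.trans ih₂
  | comp _ _ ih₁ ih₂ => simp only [F.map_comp, ih₁, ih₂]
  | tensor _ _ ih₁ ih₂ => simp only [hF.tensor_map, ih₁, ih₂]

variable (hF : IsStrictMonoidal F) (h : ∀ e, F.map (E.s₂ e) = F.map (E.t₂ e))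

/-- The functor induced on the quotient. -/
def lift : E.Cat ⥤ D where
  obj a := F.obj a.as
  map f := Quotient.lift F.map (fun _ _ c => map_eq_of_congruence hF h c) f
  map_id a := F.map_id a.as
  map_comp := by rintro _ _ _ ⟨f⟩ ⟨g⟩; exact F.map_comp f g

theorem lift_isStrictMonoidal : IsStrictMonoidal (lift hF h) where
  unit_obj := hF.unit_obj
  tensor_obj _ _ := hF.tensor_obj _ _
  tensor_map := by rintro _ _ _ _ ⟨f⟩ ⟨g⟩; exact hF.tensor_map f g

end EqTheory

/-! ### The interpretation functor -/

namespace MRel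

/-- The interpretation of the signature of bialgebras in multirelations. -/
def interp : Bialg.theory.toSignature.Interp MRel where
  obj a := of a.length
  obj_nil := rfl
  obj_append _ _ := congrArg of List.length_append
  gen := interpGen

instance (m n : MRel) : DecidableEq (m ⟶ n) :=
  inferInstanceAs (DecidableEq (Matrix (Fin m.card) (Fin n.card) ℕ))

theorem interp_rel (e : Bialg.Rel) :
    interp.functor.map (Bialg.sides e).1 = interp.functor.map (Bialg.sides e).2 := by
  -- Each relation becomes an equality of explicit small matrices over `ℕ`.
  cases e <;> decide

/-- The interpretation functor. -/
def interpretation : Bialg.theory.Cat ⥤ MRel :=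
  EqTheory.lift (E := Bialg.theory) interp.functor_isStrictMonoidal interp_rel

theorem isInterpretation : IsInterpretation interpretation where
  strict := EqTheory.lift_isStrictMonoidal _ _
  obj _ := rfl
  map_gen _ := ((Category.id_comp _).trans (Category.comp_id _)).symm

end MRel

/-! ### The generating bialgebra acts by tensoring on the left -/

namespace Bialg

/-- A syntactic morphism tensored on the right with an object, modulo the relations. -/
abbrev whisker {a b : Syn} (f : a ⟶ b) (X : theory.Cat) :
    (⟨a⟩ : theory.Cat) ⊗ X ⟶ (⟨b⟩ : theory.Cat) ⊗ X :=
  EqTheory.Cat.ofHom (E := theory) f ▷ X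

theorem whisker_rel (e : Rel) (X : theory.Cat) :
    whisker (sides e).1 X = whisker (sides e).2 X :=
  congrArg (fun f : (⟨N (relSrc e)⟩ : theory.Cat) ⟶ ⟨N (relTgt e)⟩ => f ▷ X)
    (Quotient.sound (EqTheory.Congruence.rel (E := theory) e))

theorem whisker_comp {a b c : Syn} (f : a ⟶ b) (g : b ⟶ c) (X : theory.Cat) :
    whisker (f ≫ g) X = whisker f X ≫ whisker g X :=
  comp_whiskerRight (EqTheory.Cat.ofHom (E := theory) f) (EqTheory.Cat.ofHom g) X

theorem whisker_id (a : Syn) (X : theory.Cat) : whisker (𝟙 a) X = 𝟙 _ :=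
  id_whiskerRight (⟨a⟩ : theory.Cat) X

theorem whisker_tensor_id_heq {a b : Syn} (f : a ⟶ b) (c : Syn) (X : theory.Cat) :
    HEq (whisker (f ⊗ₘ 𝟙 c) X) (whisker f (⟨c⟩ ⊗ X)) := by
  have := tensorHom_assoc_heq (EqTheory.Cat.ofHom (E := theory) f) (𝟙 ⟨c⟩) (𝟙 X)
  rwa [id_tensorHom_id, tensorHom_id, tensorHom_id] at this

theorem whisker_id_tensor_heq {a b : Syn} (f : a ⟶ b) (c : Syn) (X : theory.Cat) :
    HEq (whisker (𝟙 c ⊗ₘ f) X) ((⟨c⟩ : theory.Cat) ◁ whisker f X) := by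
  have := tensorHom_assoc_heq (𝟙 ⟨c⟩) (EqTheory.Cat.ofHom (E := theory) f) (𝟙 X)
  rwa [tensorHom_id, tensorHom_id, id_tensorHom] at this

theorem whisker_tensor {a b c d : Syn} (f : a ⟶ b) (g : c ⟶ d) (X : theory.Cat) :
    whisker (f ⊗ₘ g) X = whisker (f ⊗ₘ 𝟙 c) X ≫ whisker (𝟙 b ⊗ₘ g) X := by
  rw [← whisker_comp, tensorHom_comp_tensorHom, Category.comp_id, Category.id_comp]

/-- Tensoring on the left with the object `1`. -/
abbrev cons : theory.Cat ⥤ theory.Cat := tensorLeft ⟨N 1⟩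

theorem two_whiskerLeft {X Y : theory.Cat} (f : X ⟶ Y) :
    (⟨N 2⟩ : theory.Cat) ◁ f = cons.map (cons.map f) := by
  have := tensorHom_assoc_heq (𝟙 (⟨N 1⟩ : theory.Cat)) (𝟙 (⟨N 1⟩ : theory.Cat)) f
  rw [id_tensorHom_id, id_tensorHom, id_tensorHom, id_tensorHom] at this
  exact eq_of_heq this

theorem zero_whiskerLeft {X Y : theory.Cat} (f : X ⟶ Y) :
    (⟨N 0⟩ : theory.Cat) ◁ f = f := by
  have := id_unit_tensorHom_heq f
  rw [id_tensorHom] at this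
  exact eq_of_heq this

theorem whisker_comp_eq {a b c : Syn} {f : a ⟶ b} {g : b ⟶ c} {X : theory.Cat}
    {p : (⟨a⟩ : theory.Cat) ⊗ X ⟶ (⟨b⟩ : theory.Cat) ⊗ X}
    {q : (⟨b⟩ : theory.Cat) ⊗ X ⟶ (⟨c⟩ : theory.Cat) ⊗ X} (hf : whisker f X = p)
    (hg : whisker g X = q) : whisker (f ≫ g) X = p ≫ q := by
  rw [whisker_comp, hf, hg]

theorem eq_of_rel (e : Rel) {X : theory.Cat}
    {p q : (⟨N (relSrc e)⟩ : theory.Cat) ⊗ X ⟶ (⟨N (relTgt e)⟩ : theory.Cat) ⊗ X}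
    (hp : whisker (sides e).1 X = p) (hq : whisker (sides e).2 X = q) : p = q :=
  hp.symm.trans ((whisker_rel e X).trans hq)

/-- The words here begin with explicit letters, so the two bracketings agree definitionally and the
heterogeneous equality is an equality. The same applies to the other generators. -/
theorem whisker_mu_id (X : theory.Cat) : whisker (μ ⊗ₘ I) X = whisker μ (cons.obj X) :=
  eq_of_heq (whisker_tensor_id_heq μ (N 1) X)

theorem whisker_id_mu (X : theory.Cat) : whisker (I ⊗ₘ μ) X = cons.map (whisker μ X) :=
  eq_of_heq (whisker_id_tensor_heq μ (N 1) X)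

theorem whisker_eta_id (X : theory.Cat) : whisker (η ⊗ₘ I) X = whisker η (cons.obj X) :=
  eq_of_heq (whisker_tensor_id_heq η (N 1) X)

theorem whisker_id_eta (X : theory.Cat) : whisker (I ⊗ₘ η) X = cons.map (whisker η X) :=
  eq_of_heq (whisker_id_tensor_heq η (N 1) X)

theorem whisker_delta_id (X : theory.Cat) : whisker (δ ⊗ₘ I) X = whisker δ (cons.obj X) :=
  eq_of_heq (whisker_tensor_id_heq δ (N 1) X)

theorem whisker_id_delta (X : theory.Cat) : whisker (I ⊗ₘ δ) X = cons.map (whisker δ X) :=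
  eq_of_heq (whisker_id_tensor_heq δ (N 1) X)

theorem whisker_eps_id (X : theory.Cat) : whisker (ε ⊗ₘ I) X = whisker ε (cons.obj X) :=
  eq_of_heq (whisker_tensor_id_heq ε (N 1) X)

theorem whisker_id_eps (X : theory.Cat) : whisker (I ⊗ₘ ε) X = cons.map (whisker ε X) :=
  eq_of_heq (whisker_id_tensor_heq ε (N 1) X)

theorem whisker_gam_id (X : theory.Cat) : whisker (γ ⊗ₘ I) X = whisker γ (cons.obj X) :=
  eq_of_heq (whisker_tensor_id_heq γ (N 1) X)

theorem whisker_id_gam (X : theory.Cat) : whisker (I ⊗ₘ γ) X = cons.map (whisker γ X) :=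
  eq_of_heq (whisker_id_tensor_heq γ (N 1) X)

theorem whisker_id_gam_id (X : theory.Cat) :
    whisker IγI X = cons.map (whisker γ (cons.obj X)) :=
  (eq_of_heq (whisker_tensor_id_heq Iγ (N 1) X)).trans (whisker_id_gam (cons.obj X))

theorem whisker_delta_delta (X : theory.Cat) : whisker (δ ⊗ₘ δ) X =
    whisker δ (cons.obj X) ≫ cons.map (cons.map (whisker δ X)) :=
  (whisker_tensor δ δ X).trans (congrArg₂ CategoryStruct.comp (whisker_delta_id X)
    ((eq_of_heq (whisker_id_tensor_heq δ (N 2) X)).trans (two_whiskerLeft _)))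

theorem whisker_mu_mu (X : theory.Cat) : whisker (μ ⊗ₘ μ) X =
    whisker μ (cons.obj (cons.obj X)) ≫ cons.map (whisker μ X) :=
  (whisker_tensor μ μ X).trans (congrArg₂ CategoryStruct.comp
    (eq_of_heq (whisker_tensor_id_heq μ (N 2) X)) (whisker_id_mu X))

theorem whisker_eta_eta (X : theory.Cat) : whisker (η ⊗ₘ η) X =
    whisker η X ≫ cons.map (whisker η X) :=
  (whisker_tensor η η X).trans (congrArg₂ CategoryStruct.comp
    (eq_of_heq (whisker_tensor_id_heq η (N 0) X)) (whisker_id_eta X))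

theorem whisker_eps_eps (X : theory.Cat) : whisker (ε ⊗ₘ ε) X =
    whisker ε (cons.obj X) ≫ whisker ε X :=
  (whisker_tensor ε ε X).trans (congrArg₂ CategoryStruct.comp (whisker_eps_id X)
    ((eq_of_heq (whisker_id_tensor_heq ε (N 0) X)).trans (zero_whiskerLeft _)))

/-- The action of the bialgebra `1` on the category generated by the theory. -/
def action : BialgebraAction theory.Cat where
  T := cons
  mul :=
    { app X := whisker μ X
      naturality X Y f := by
        -- Naturality in the right-hand factor is the interchange law; this holds for all five
        -- generators.
        refine .trans ?_ (whisker_exchange (EqTheory.Cat.gen theory .mu) f)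
        rw [two_whiskerLeft]; rfl }
  one :=
    { app X := whisker η X
      naturality X Y f := by
        refine .trans ?_ (whisker_exchange (EqTheory.Cat.gen theory .eta) f)
        rw [zero_whiskerLeft]; rfl }
  comul :=
    { app X := whisker δ X
      naturality X Y f := by
        refine (whisker_exchange (EqTheory.Cat.gen theory .delta) f).trans ?_
        rw [two_whiskerLeft]; rfl }
  counit :=
    { app X := whisker ε X
      naturality X Y f := by
        refine (whisker_exchange (EqTheory.Cat.gen theory .eps) f).trans ?_
        rw [zero_whiskerLeft]; rfl }
  swap :=
    { app X := whisker γ X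
      naturality X Y f := by
        refine .trans (congrArg (· ≫ _) (two_whiskerLeft f).symm) ?_
        refine (whisker_exchange (EqTheory.Cat.gen theory .gam) f).trans ?_
        exact congrArg (_ ≫ ·) (two_whiskerLeft f) }
  swap_swap X := eq_of_rel .symSym (whisker_comp_eq rfl rfl) (whisker_id _ X)
  yangBaxter X := eq_of_rel .yangBaxter
    (whisker_comp_eq (whisker_id_gam X) (whisker_comp_eq (whisker_gam_id X) (whisker_id_gam X)))
    (whisker_comp_eq (whisker_gam_id X) (whisker_comp_eq (whisker_id_gam X) (whisker_gam_id X)))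
  mul_assoc X := eq_of_rel .mulAssoc (whisker_comp_eq (whisker_mu_id X) rfl)
    (whisker_comp_eq (whisker_id_mu X) rfl)
  one_mul X := eq_of_rel .unitMul (whisker_comp_eq (whisker_eta_id X) rfl) (whisker_id _ X)
  mul_one X := eq_of_rel .mulUnit (whisker_comp_eq (whisker_id_eta X) rfl) (whisker_id _ X)
  mul_swap X := eq_of_rel .mulNatL (whisker_comp_eq (whisker_mu_id X) rfl)
    (whisker_comp_eq (whisker_id_gam X) (whisker_comp_eq (whisker_gam_id X) (whisker_id_mu X)))
  map_mul_swap X := eq_of_rel .mulNatR (whisker_comp_eq (whisker_id_mu X) rfl)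
    (whisker_comp_eq (whisker_gam_id X) (whisker_comp_eq (whisker_id_gam X) (whisker_mu_id X)))
  map_one_swap X := eq_of_rel .unitNatR (whisker_comp_eq (whisker_id_eta X) rfl)
    (whisker_eta_id X)
  swap_mul X := eq_of_rel .mulComm (whisker_comp_eq rfl rfl) rfl
  comul_assoc X := eq_of_rel .comulCoassoc (whisker_comp_eq rfl (whisker_delta_id X))
    (whisker_comp_eq rfl (whisker_id_delta X))
  comul_counit X := eq_of_rel .counitComul (whisker_comp_eq rfl (whisker_eps_id X)) (whisker_id _ X)
  comul_map_counit X := eq_of_rel .comulCounit (whisker_comp_eq rfl (whisker_id_eps X))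
    (whisker_id _ X)
  swap_comul X := eq_of_rel .comulNatL (whisker_comp_eq rfl (whisker_delta_id X))
    (whisker_comp_eq (whisker_id_delta X) (whisker_comp_eq (whisker_gam_id X) (whisker_id_gam X)))
  swap_map_comul X := eq_of_rel .comulNatR (whisker_comp_eq rfl (whisker_id_delta X))
    (whisker_comp_eq (whisker_delta_id X) (whisker_comp_eq (whisker_id_gam X) (whisker_gam_id X)))
  swap_counit X := eq_of_rel .counitNatL (whisker_comp_eq rfl (whisker_eps_id X))
    (whisker_id_eps X)
  swap_map_counit X := eq_of_rel .counitNatR (whisker_comp_eq rfl (whisker_id_eps X))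
    (whisker_eps_id X)
  comul_swap X := eq_of_rel .comulComm (whisker_comp_eq rfl rfl) rfl
  mul_comul X := (eq_of_rel .mulComul (whisker_comp_eq rfl rfl)
    (whisker_comp_eq (whisker_delta_delta X)
      (whisker_comp_eq (whisker_id_gam_id X) (whisker_mu_mu X)))).trans (Category.assoc _ _ _)
  one_comul X := eq_of_rel .unitComul (whisker_comp_eq rfl rfl) (whisker_eta_eta X)
  mul_counit X := eq_of_rel .mulCounit (whisker_comp_eq rfl rfl) (whisker_eps_eps X)
  one_counit X := eq_of_rel .unitCounit (whisker_comp_eq rfl rfl) (whisker_id _ X)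

end Bialg

/-! ### Matrices acting on row vectors -/

namespace MRel

/-- The action of a morphism on row vectors. -/
abbrev act {X Y : Bialg.theory.Cat} (f : X ⟶ Y) (v : Fin X.as.word.length → ℕ) :
    Fin Y.as.word.length → ℕ :=
  Matrix.vecMul v (coeff (interpretation.map f))

theorem act_id (X : Bialg.theory.Cat) (v : Fin X.as.word.length → ℕ) : act (𝟙 X) v = v := by
  rw [act, interpretation.map_id]
  exact Matrix.vecMul_one v

theorem act_comp {X Y Z : Bialg.theory.Cat} (f : X ⟶ Y) (g : Y ⟶ Z)
    (v : Fin X.as.word.length → ℕ) : act (f ≫ g) v = act g (act f v) := by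
  rw [act, interpretation.map_comp]
  exact (Matrix.vecMul_vecMul v _ _).symm

/-- Concatenation of row vectors. -/
def join {a b : List Unit} (u : Fin a.length → ℕ) (v : Fin b.length → ℕ) :
    Fin (a ++ b).length → ℕ :=
  fun i => Fin.append u v (Fin.cast List.length_append i)

theorem append_vecMul_sum {m n p q : ℕ} (R : Matrix (Fin m) (Fin n) ℕ)
    (R' : Matrix (Fin p) (Fin q) ℕ) (u : Fin m → ℕ) (v : Fin p → ℕ) :
    Matrix.vecMul (Fin.append u v) (sum R R') =
      Fin.append (Matrix.vecMul u R) (Matrix.vecMul v R') := by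
  ext j
  refine Fin.addCases (fun j => ?_) (fun j => ?_) j <;>
  simp [Matrix.vecMul, dotProduct, Fin.sum_univ_add, sum_inl_inl, sum_inl_inr, sum_inr_inl,
    sum_inr_inr]

/-- The tensor product is block-diagonal up to the casts identifying the length of a concatenation
with the sum of the lengths. -/
theorem act_tensor {X₁ Y₁ X₂ Y₂ : Bialg.theory.Cat} (f : X₁ ⟶ Y₁) (g : X₂ ⟶ Y₂)
    (u : Fin X₁.as.word.length → ℕ) (v : Fin X₂.as.word.length → ℕ) :
    act (f ⊗ₘ g) (join u v) = join (act f u) (act g v) := by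
  have h (i j) : coeff (interpretation.map (f ⊗ₘ g)) i j =
      sum (coeff (interpretation.map f)) (coeff (interpretation.map g))
        (Fin.cast List.length_append i) (Fin.cast List.length_append j) := by
    rw [isInterpretation.strict.tensor_map, coeff_eqToHom_comp, coeff_comp_eqToHom]
    rfl
  ext j
  refine .trans ?_ (congrFun (append_vecMul_sum (coeff (interpretation.map f))
    (coeff (interpretation.map g)) u v) (Fin.cast List.length_append j))
  exact Fintype.sum_equiv (finCongr List.length_append) _ _ fun i =>
    congrArg (join u v i * ·) (h i j)

theorem join_nil (u : Fin ([] : List Unit).length → ℕ) {b : List Unit} (v : Fin b.length → ℕ) :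
    join u v = v := by
  ext i
  have : Fin.cast List.length_append i = Fin.natAdd ([] : List Unit).length i := by ext; simp
  rw [join, this, Fin.append_right]

theorem join_one (u : Fin [()].length → ℕ) {b : List Unit} (v : Fin b.length → ℕ) :
    join u v = Matrix.vecCons (u 0) v := by
  ext i
  refine Fin.cases ?_ (fun i => ?_) i
  · exact Fin.append_left u v 0
  · have : Fin.cast (List.length_append (as := [()]) (bs := b)) (Fin.succ i) =
        Fin.natAdd [()].length i := by
      ext; simp [Nat.add_comm]
    exact (congrArg _ this).trans (Fin.append_right u v i)

theorem join_two (u : Fin [(), ()].length → ℕ) {b : List Unit} (v : Fin b.length → ℕ) :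
    join u v = Matrix.vecCons (u 0) (Matrix.vecCons (u 1) v) := by
  ext i
  refine Fin.cases ?_ (fun i => Fin.cases ?_ (fun i => ?_) i) i
  · exact Fin.append_left u v 0
  · exact Fin.append_left u v 1
  · have : Fin.cast (List.length_append (as := [(), ()]) (bs := b)) (Fin.succ (Fin.succ i)) =
        Fin.natAdd [(), ()].length i := by
      ext; simp; omega
    exact (congrArg _ this).trans (Fin.append_right u v i)

end MRel

namespace Bialg

open MRel

theorem act_cons {X Y : theory.Cat} (f : X ⟶ Y) (c : ℕ) (v : Fin X.as.word.length → ℕ) :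
    act (action.T.map f) (Matrix.vecCons c v) = Matrix.vecCons c (act f v) := by
  have h := act_tensor (𝟙 (⟨N 1⟩ : theory.Cat)) f (fun _ => c) v
  rw [act_id, id_tensorHom] at h
  exact ((congrArg _ (join_one (fun _ => c) v)).symm.trans h).trans (join_one _ _)

theorem act_gen (x : Gen) (X : theory.Cat) (u : Fin (theory.s₁ x).length → ℕ)
    (v : Fin X.as.word.length → ℕ) :
    act (EqTheory.Cat.gen theory x ▷ X) (join u v) =
      join (Matrix.vecMul u (coeff (interpGen x))) v := by
  have h := act_tensor (EqTheory.Cat.gen theory x) (𝟙 X) u v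
  rw [act_id, tensorHom_id] at h
  exact h

theorem act_mul (X : theory.Cat) (c d : ℕ) (v : Fin X.as.word.length → ℕ) :
    act (action.mul.app X) (Matrix.vecCons c (Matrix.vecCons d v)) =
      Matrix.vecCons (c + d) v := by
  refine (congrArg _ (join_two ![c, d] v).symm).trans ((act_gen .mu X ![c, d] v).trans ?_)
  refine (join_one _ _).trans (congrArg (Matrix.vecCons · v) ?_)
  change Matrix.vecMul ![c, d] !![1; 1] 0 = c + d
  simp [Matrix.vecMul, dotProduct]

theorem act_one (X : theory.Cat) (v : Fin X.as.word.length → ℕ) :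
    act (action.one.app X) v = Matrix.vecCons 0 v := by
  refine (congrArg _ (join_nil ![] v).symm).trans ((act_gen .eta X ![] v).trans ?_)
  refine (join_one _ _).trans (congrArg (Matrix.vecCons · v) ?_)
  change Matrix.vecMul ![] (0 : Matrix (Fin 0) (Fin 1) ℕ) 0 = 0
  simp

theorem act_comul (X : theory.Cat) (c : ℕ) (v : Fin X.as.word.length → ℕ) :
    act (action.comul.app X) (Matrix.vecCons c v) =
      Matrix.vecCons c (Matrix.vecCons c v) := by
  refine (congrArg _ (join_one ![c] v).symm).trans ((act_gen .delta X ![c] v).trans ?_)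
  refine (join_two _ _).trans ?_
  have h : Matrix.vecMul ![c] !![1, 1] = ![c, c] := by
    ext i; fin_cases i <;> simp
  exact congrArg (fun w : Fin 2 → ℕ => Matrix.vecCons (w 0) (Matrix.vecCons (w 1) v)) h

theorem act_counit (X : theory.Cat) (c : ℕ) (v : Fin X.as.word.length → ℕ) :
    act (action.counit.app X) (Matrix.vecCons c v) = v :=
  (congrArg _ (join_one ![c] v).symm).trans ((act_gen .eps X ![c] v).trans (join_nil _ v))

theorem act_swap (X : theory.Cat) (c d : ℕ) (v : Fin X.as.word.length → ℕ) :
    act (action.swap.app X) (Matrix.vecCons c (Matrix.vecCons d v)) =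
      Matrix.vecCons d (Matrix.vecCons c v) := by
  refine (congrArg _ (join_two ![c, d] v).symm).trans ((act_gen .gam X ![c, d] v).trans ?_)
  refine (join_two _ _).trans ?_
  have h : Matrix.vecMul ![c, d] !![0, 1; 1, 0] = ![d, c] := by
    ext i; fin_cases i <;> simp [Matrix.vecMul, dotProduct]
  exact congrArg (fun w : Fin 2 → ℕ => Matrix.vecCons (w 0) (Matrix.vecCons (w 1) v)) h

theorem act_pass (k : ℕ) (X : theory.Cat) (c d : ℕ) (v : Fin X.as.word.length → ℕ) :
    act (action.pass k X) (Matrix.vecCons c (Matrix.vecCons d v)) =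
      Matrix.vecCons (d + k * c) (Matrix.vecCons c v) := by
  induction k with
  | zero => rw [Nat.zero_mul]; exact act_swap X c d v
  | succ k ih =>
    refine (act_comp _ _ _).trans ((act_comp _ _ _).trans ?_)
    refine (congrArg (fun w => act _ (act _ w)) (act_comul (action.T.obj X) c _)).trans ?_
    refine (congrArg (act _) ((act_cons _ c _).trans (congrArg (Matrix.vecCons c) ih))).trans ?_
    refine (act_mul (action.T.obj X) c _ _).trans (congrArg (Matrix.vecCons · _) ?_)
    ring

end Bialg

/-! ### Normal forms -/

namespace Bialg

open MRel

/-- The morphism `1 + y ⟶ y` that adds `r i` copies of the first wire to the `i`-th other one. -/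
def absorb : ∀ (y : List Unit), (Fin y.length → ℕ) →
    (action.T.obj (⟨⟨y⟩⟩ : theory.Cat) ⟶ (⟨⟨y⟩⟩ : theory.Cat))
  | [], _ => action.counit.app _
  | _ :: y, r => action.pass (r 0) ⟨⟨y⟩⟩ ≫ action.T.map (absorb y (Matrix.vecTail r))

/-- The tensor power of the unit `η`. -/
def units : ∀ (y : List Unit), (⟨⟨[]⟩⟩ : theory.Cat) ⟶ (⟨⟨y⟩⟩ : theory.Cat)
  | [] => 𝟙 _
  | _ :: y => units y ≫ action.one.app ⟨⟨y⟩⟩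

/-- The normal form of the morphisms interpreted by a given multirelation. -/
def normalForm (Y : theory.Cat) : ∀ (x : List Unit),
    (Fin x.length → Fin Y.as.word.length → ℕ) → ((⟨⟨x⟩⟩ : theory.Cat) ⟶ Y)
  | [], _ => units Y.as.word
  | _ :: x, R => action.T.map (normalForm Y x (Matrix.vecTail R)) ≫ absorb Y.as.word (R 0)

theorem act_absorb (y : List Unit) (r v : Fin y.length → ℕ) (c : ℕ) :
    act (absorb y r) (Matrix.vecCons c v) = v + c • r := by
  induction y with
  | nil => exact funext fun i => i.elim0
  | cons _ y ih =>
    obtain ⟨d, v, rfl⟩ : ∃ d w, v = Matrix.vecCons d w :=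
      ⟨_, _, (Matrix.cons_head_tail v).symm⟩
    refine (act_comp _ _ _).trans ((congrArg (act _) (act_pass (r 0) ⟨⟨y⟩⟩ c d v)).trans ?_)
    refine (act_cons _ _ _).trans ((congrArg _ (ih _ v)).trans ?_)
    refine funext fun i => Fin.cases ?_ (fun i => rfl) i
    exact congrArg (d + ·) (Nat.mul_comm _ _)

theorem act_units (y : List Unit) (v : Fin ([] : List Unit).length → ℕ) :
    act (units y) v = 0 := by
  induction y with
  | nil => exact funext fun i => i.elim0
  | cons _ y ih =>
    refine (act_comp _ _ _).trans ((act_one _ _).trans ((congrArg _ ih).trans ?_))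
    exact funext fun i => Fin.cases rfl (fun _ => rfl) i

theorem act_normalForm (Y : theory.Cat) (x : List Unit)
    (R : Fin x.length → Fin Y.as.word.length → ℕ) (v : Fin x.length → ℕ) :
    act (normalForm Y x R) v = Matrix.vecMul v (Matrix.of R) := by
  induction x with
  | nil => exact (act_units _ v).trans (Matrix.empty_vecMul v (Matrix.of R)).symm
  | cons _ x ih =>
    obtain ⟨c, v, rfl⟩ : ∃ d w, v = Matrix.vecCons d w :=
      ⟨_, _, (Matrix.cons_head_tail v).symm⟩
    refine (act_comp (action.T.map (normalForm Y x (Matrix.vecTail R)))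
      (absorb Y.as.word (R 0)) _).trans ?_
    refine (congrArg (act (absorb Y.as.word (R 0)))
      (act_cons (normalForm Y x (Matrix.vecTail R)) c v)).trans ?_
    refine (act_absorb _ _ _ _).trans ?_
    rw [ih]
    exact (add_comm _ _).trans (Matrix.cons_vecMul c v (Matrix.of R)).symm

theorem map_normalForm (X Y : theory.Cat) (R : interpretation.obj X ⟶ interpretation.obj Y) :
    interpretation.map (normalForm Y X.as.word R) = R := by
  refine Matrix.ext fun i j => ?_
  -- A matrix is recovered from its values on the basis vectors.
  have h (M : Matrix (Fin X.as.word.length) (Fin Y.as.word.length) ℕ) :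
      Matrix.vecMul (Pi.single i 1) M j = M i j := congrFun (Matrix.single_one_vecMul i M) j
  exact (h _).symm.trans ((congrFun (act_normalForm Y X.as.word R (Pi.single i 1)) j).trans (h _))

/-! ### Every morphism is provably linear -/

/-- Morphisms that can be slid past `absorb`, and that preserve `units`. -/
structure Slides {X Y : theory.Cat} (f : X ⟶ Y) : Prop where
  absorb_comp : ∀ r : Fin X.as.word.length → ℕ,
    absorb X.as.word r ≫ f = action.T.map f ≫ absorb Y.as.word (act f r)
  units_comp : units X.as.word ≫ f = units Y.as.word

namespace Slides

theorem id (X : theory.Cat) : Slides (𝟙 X) where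
  absorb_comp r := by
    rw [act_id, action.T.map_id]
    exact (Category.comp_id _).trans (Category.id_comp _).symm
  units_comp := Category.comp_id _

theorem comp {X Y Z : theory.Cat} {f : X ⟶ Y} {g : Y ⟶ Z} (hf : Slides f) (hg : Slides g) :
    Slides (f ≫ g) where
  absorb_comp r := by
    rw [act_comp, action.T.map_comp, Category.assoc, ← hg.absorb_comp, ← Category.assoc,
      hf.absorb_comp, Category.assoc]
  units_comp := by rw [← Category.assoc, hf.units_comp, hg.units_comp]

theorem map {X Y : theory.Cat} {f : X ⟶ Y} (hf : Slides f) : Slides (action.T.map f) where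
  absorb_comp r := by
    obtain ⟨c, r, rfl⟩ : ∃ d w, r = Matrix.vecCons d w :=
      ⟨_, _, (Matrix.cons_head_tail r).symm⟩
    refine (action.slide_map _ c f _ (hf.absorb_comp r)).trans ?_
    exact congrArg (fun v => action.T.map (action.T.map f) ≫ absorb (() :: Y.as.word) v)
      (act_cons f c r).symm
  units_comp := by
    refine (Category.assoc _ _ _).trans ?_
    refine (congrArg (units X.as.word ≫ ·) (action.comp_one f).symm).trans ?_
    refine (Category.assoc _ _ _).symm.trans ?_
    exact congrArg (· ≫ action.one.app Y) hf.units_comp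

theorem mul (X : theory.Cat) : Slides (action.mul.app X) where
  absorb_comp r := by
    obtain ⟨c, r, rfl⟩ : ∃ d w, r = Matrix.vecCons d w :=
      ⟨_, _, (Matrix.cons_head_tail r).symm⟩
    obtain ⟨d, r, rfl⟩ : ∃ d w, r = Matrix.vecCons d w :=
      ⟨_, _, (Matrix.cons_head_tail r).symm⟩
    refine (action.slide_mul (absorb X.as.word r) c d).trans ?_
    exact congrArg (fun v => action.T.map (action.mul.app X) ≫ absorb (() :: X.as.word) v)
      (act_mul X c d r).symm
  units_comp := by
    refine (Category.assoc _ _ _).trans ?_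
    exact (congrArg (_ ≫ ·) (action.one_mul X)).trans (Category.comp_id _)

theorem one (X : theory.Cat) : Slides (action.one.app X) where
  absorb_comp r := by
    refine (action.slide_one (absorb X.as.word r)).trans ?_
    exact congrArg (fun v => action.T.map (action.one.app X) ≫ absorb (() :: X.as.word) v)
      (act_one X r).symm
  units_comp := rfl

theorem comul (X : theory.Cat) : Slides (action.comul.app X) where
  absorb_comp r := by
    obtain ⟨c, r, rfl⟩ : ∃ d w, r = Matrix.vecCons d w :=
      ⟨_, _, (Matrix.cons_head_tail r).symm⟩
    refine (action.slide_comul (absorb X.as.word r) c).trans ?_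
    exact congrArg
      (fun v => action.T.map (action.comul.app X) ≫ absorb (() :: () :: X.as.word) v)
      (act_comul X c r).symm
  units_comp := by
    refine (Category.assoc _ _ _).trans (.trans ?_ (Category.assoc _ _ _).symm)
    exact congrArg (units X.as.word ≫ ·) ((action.one_comul X).trans (action.one_one X).symm)

theorem counit (X : theory.Cat) : Slides (action.counit.app X) where
  absorb_comp r := by
    obtain ⟨c, r, rfl⟩ : ∃ d w, r = Matrix.vecCons d w :=
      ⟨_, _, (Matrix.cons_head_tail r).symm⟩
    refine (action.slide_counit (absorb X.as.word r) c).trans ?_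
    exact congrArg (fun v => action.T.map (action.counit.app X) ≫ absorb X.as.word v)
      (act_counit X c r).symm
  units_comp := by
    refine (Category.assoc _ _ _).trans ?_
    exact (congrArg (_ ≫ ·) (action.one_counit X)).trans (Category.comp_id _)

theorem swap (X : theory.Cat) : Slides (action.swap.app X) where
  absorb_comp r := by
    obtain ⟨c, r, rfl⟩ : ∃ d w, r = Matrix.vecCons d w :=
      ⟨_, _, (Matrix.cons_head_tail r).symm⟩
    obtain ⟨d, r, rfl⟩ : ∃ d w, r = Matrix.vecCons d w :=
      ⟨_, _, (Matrix.cons_head_tail r).symm⟩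
    refine (action.slide_swap (absorb X.as.word r) c d).trans ?_
    exact congrArg
      (fun v => action.T.map (action.swap.app X) ≫ absorb (() :: () :: X.as.word) v)
      (act_swap X c d r).symm
  units_comp := by
    refine (congrArg (· ≫ _) (Category.assoc _ _ _)).trans ((Category.assoc _ _ _).trans ?_)
    refine .trans ?_ (Category.assoc _ _ _).symm
    exact congrArg (units X.as.word ≫ ·) (action.one_one_swap X)

theorem of_heq {X Y X' Y' : theory.Cat} {f : X ⟶ Y} {g : X' ⟶ Y'} (hX : X = X') (hY : Y = Y')
    (h : HEq f g) (hg : Slides g) : Slides f := by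
  subst hX hY h; exact hg

/-- Tensoring on the left with a word is an iterate of `1 ⊗ -`, so this reduces to `Slides.map`. -/
theorem whiskerLeft (w : List Unit) {X Y : theory.Cat} {f : X ⟶ Y} (hf : Slides f) :
    Slides ((⟨⟨w⟩⟩ : theory.Cat) ◁ f) := by
  induction w with
  | nil =>
    have h := id_unit_tensorHom_heq f
    rw [id_tensorHom] at h
    exact of_heq (StrictMonoidal.unit_obj X) (StrictMonoidal.unit_obj Y) h hf
  | cons _ w ih =>
    have h := tensorHom_assoc_heq (𝟙 (⟨N 1⟩ : theory.Cat)) (𝟙 (⟨⟨w⟩⟩ : theory.Cat)) f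
    rw [id_tensorHom_id, id_tensorHom, id_tensorHom, id_tensorHom] at h
    exact of_heq rfl rfl h ih.map

/-- The arbitrary `X` on the right makes the induction go through: `f ⊗ g` beside `X` is `f` beside
`c ⊗ X`, followed by `g` beside `X` with `b` on the left. -/
theorem whiskerRight_ofTerm {a b : List sig.E₁} (f : sig.Term a b) (X : theory.Cat) :
    Slides (whisker (Signature.FreeCat.ofTerm f) X) := by
  induction f generalizing X with
  | gen x =>
    cases x
    · exact mul X
    · exact one X
    · exact comul X
    · exact counit X
    · exact swap X
  | id a => exact (whisker_id ⟨a⟩ X).symm ▸ id _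
  | comp f g ihf ihg =>
    exact (whisker_comp (Signature.FreeCat.ofTerm f) (Signature.FreeCat.ofTerm g) X).symm ▸
      (ihf X).comp (ihg X)
  | @tensor a b c d f g ihf ihg =>
    have h := tensorHom_assoc_heq
      (EqTheory.Cat.ofHom (E := theory) (Signature.FreeCat.ofTerm f))
      (EqTheory.Cat.ofHom (E := theory) (Signature.FreeCat.ofTerm g)) (𝟙 X)
    rw [tensorHom_id, tensorHom_id, MonoidalCategory.tensorHom_def
      (EqTheory.Cat.ofHom (E := theory) (Signature.FreeCat.ofTerm f))
      (EqTheory.Cat.ofHom (E := theory) (Signature.FreeCat.ofTerm g) ▷ X)] at h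
    exact of_heq (StrictMonoidal.assoc_obj (⟨⟨a⟩⟩ : theory.Cat) ⟨⟨c⟩⟩ X)
      (StrictMonoidal.assoc_obj (⟨⟨b⟩⟩ : theory.Cat) ⟨⟨d⟩⟩ X) h
      ((ihf _).comp ((ihg X).whiskerLeft b))

theorem of_hom {X Y : theory.Cat} (f : X ⟶ Y) : Slides f := by
  obtain ⟨f, rfl⟩ := Quotient.exists_rep f
  obtain ⟨f, rfl⟩ := Quotient.exists_rep f
  have h := tensorHom_id_unit_heq
    (EqTheory.Cat.ofHom (E := theory) (Signature.FreeCat.ofTerm f))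
  rw [tensorHom_id] at h
  exact of_heq (StrictMonoidal.obj_unit X).symm (StrictMonoidal.obj_unit Y).symm h.symm
    (whiskerRight_ofTerm f (𝟙_ theory.Cat))

end Slides

/-! ### Full faithfulness -/

theorem normalForm_comp (x : List Unit) {Y Z : theory.Cat} (f : Y ⟶ Z)
    (R : Fin x.length → Fin Y.as.word.length → ℕ) :
    normalForm Y x R ≫ f = normalForm Z x (fun i => act f (R i)) := by
  induction x with
  | nil => exact (Slides.of_hom f).units_comp
  | cons _ x ih =>
    refine (Category.assoc _ _ _).trans ?_
    refine (congrArg (_ ≫ ·) ((Slides.of_hom f).absorb_comp (R 0))).trans ?_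
    refine (Category.assoc _ _ _).symm.trans (congrArg (· ≫ _) ?_)
    exact (action.T.map_comp _ _).symm.trans (congrArg action.T.map (ih _))

theorem absorb_zero (y : List Unit) : absorb y 0 = action.counit.app ⟨⟨y⟩⟩ := by
  induction y with
  | nil => rfl
  | cons _ y ih =>
    exact (congrArg (fun f => action.pass 0 ⟨⟨y⟩⟩ ≫ action.T.map f) ih).trans
      (action.swap_map_counit ⟨⟨y⟩⟩)

/-- Split off the first row of the identity matrix. The remaining rows are those of the smaller
identity with a `0` prepended, so their normal form is `η` beside the identity. Absorbing the first
row `(1, 0, …, 0)` is `pass 1` followed by a discard. Now `pass 1` fed with `η` is `δ`, and the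
counit law concludes. -/
theorem normalForm_one (x : List Unit) :
    normalForm ⟨⟨x⟩⟩ x (1 : Matrix (Fin x.length) (Fin x.length) ℕ) = 𝟙 _ := by
  induction x with
  | nil => rfl
  | cons c x ih =>
    have h : normalForm ⟨⟨c :: x⟩⟩ x (Matrix.vecTail
        (1 : Matrix (Fin (x.length + 1)) (Fin (x.length + 1)) ℕ)) = action.one.app ⟨⟨x⟩⟩ := by
      -- By the inductive hypothesis, `η` beside the identity is a normal form followed by a
      -- morphism, hence itself a normal form.
      refine .trans ?_ ((normalForm_comp x (action.one.app ⟨⟨x⟩⟩)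
        (1 : Matrix (Fin x.length) (Fin x.length) ℕ)).symm.trans
        ((congrArg (· ≫ action.one.app ⟨⟨x⟩⟩) ih).trans (Category.id_comp _)))
      refine congrArg (normalForm ⟨⟨c :: x⟩⟩ x) (funext fun i => ?_)
      refine .trans ?_ (act_one ⟨⟨x⟩⟩ _).symm
      refine funext fun j => Fin.cases ?_ (fun j => ?_) j
      · exact Matrix.one_apply_ne (Fin.succ_ne_zero i)
      · exact (Matrix.one_apply).trans
          ((if_congr Fin.succ_inj rfl rfl).trans (Matrix.one_apply).symm)
    have h' : absorb (c :: x) ((1 : Matrix (Fin (x.length + 1)) (Fin (x.length + 1)) ℕ) 0) =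
        action.pass 1 ⟨⟨x⟩⟩ ≫ action.T.map (action.counit.app ⟨⟨x⟩⟩) := by
      rw [← absorb_zero]
      refine congrArg (fun v => action.pass 1 ⟨⟨x⟩⟩ ≫ action.T.map (absorb x v)) ?_
      exact funext fun j => Matrix.one_apply_ne (Fin.succ_ne_zero j).symm
    refine (congrArg₂ (fun f g => action.T.map f ≫ g) h h').trans ?_
    refine (Category.assoc _ _ _).symm.trans ?_
    refine (congrArg (· ≫ _) (action.map_one_pass_one ⟨⟨x⟩⟩)).trans ?_
    exact action.comul_map_counit ⟨⟨x⟩⟩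

/-- Write `f` as the identity followed by `f`, and replace the identity by its normal form. -/
theorem normalForm_map {X Y : theory.Cat} (f : X ⟶ Y) :
    normalForm Y X.as.word (interpretation.map f) = f := by
  refine .trans ?_ ((normalForm_comp X.as.word f
    (1 : Matrix (Fin X.as.word.length) (Fin X.as.word.length) ℕ)).symm.trans
    ((congrArg (· ≫ f) (normalForm_one X.as.word)).trans (Category.id_comp f)))
  refine congrArg (normalForm Y X.as.word) (funext fun i => ?_)
  refine .trans ?_ (Matrix.mul_apply_eq_vecMul
    (1 : Matrix (Fin X.as.word.length) (Fin X.as.word.length) ℕ)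
    (coeff (interpretation.map f)) i)
  rw [Matrix.one_mul]

instance : interpretation.Full where
  map_surjective R := ⟨_, map_normalForm _ _ R⟩

instance : interpretation.Faithful where
  map_injective {X Y f g} h := by
    rw [← normalForm_map f, h, normalForm_map]

end Bialg

/-! ### Strict inverses and monoidal equivalence -/

section StrictInverse

variable {C : Type u} [Category.{v} C] [MonoidalCategory C]
variable {D : Type u₁} [Category.{v₁} D] [MonoidalCategory D]

theorem eqToHom_tensorHom_eqToHom {X Y X' Y' : C} (h : X = Y) (h' : X' = Y') :
    eqToHom h ⊗ₘ eqToHom h' = eqToHom (congrArg₂ (· ⊗ ·) h h') := by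
  subst h h'; simp

/-- All components are transports, so each condition compares two transports between the same
objects. -/
theorem isMonoidalTrans_eqToHom {F G : C ⥤ D} (hF : IsStrictMonoidal F) (hG : IsStrictMonoidal G)
    (h : F = G) : IsMonoidalTrans hF hG (eqToHom h) where
  unit_app := eqToHom_app h _
  tensor_app X Y := by
    simp [eqToHom_app, eqToHom_tensorHom_eqToHom]

/-- A strict monoidal functor that is fully faithful and bijective on objects has a strict monoidal
inverse. -/
theorem IsStrictMonoidal.exists_inverse {F : C ⥤ D} [F.Full] [F.Faithful] (hF : IsStrictMonoidal F)
    (o : D → C) (h₁ : ∀ X, o (F.obj X) = X) (h₂ : ∀ Y, F.obj (o Y) = Y) :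
    ∃ G : D ⥤ C, IsStrictMonoidal G ∧ F ⋙ G = 𝟭 C ∧ G ⋙ F = 𝟭 D := by
  let G : D ⥤ C :=
    { obj := o
      map := fun {X Y} f => F.preimage (eqToHom (h₂ X) ≫ f ≫ eqToHom (h₂ Y).symm)
      map_id := fun X => F.map_injective (by simp)
      map_comp := fun f g => F.map_injective (by simp) }
  -- Up to transport, `G` is a section of `F` on morphisms; with faithfulness of `F` this reduces
  -- the laws for `G` to those for `F`.
  have hG {X Y : D} (f : X ⟶ Y) : HEq (F.map (G.map f)) f := by
    rw [F.map_preimage]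
    exact eqToHom_comp_comp_eqToHom_heq _ _ _
  have ho (X Y : D) : o (X ⊗ Y) = o X ⊗ o Y := by
    rw [← h₁ (o X ⊗ o Y), hF.tensor_obj, h₂, h₂]
  refine ⟨G, ⟨?_, ho, ?_⟩, ?_, ?_⟩
  · exact (congrArg o hF.unit_obj).symm.trans (h₁ _)
  · intro X₁ Y₁ X₂ Y₂ f g
    refine F.map_injective (eq_of_heq ((hG _).trans ?_))
    rw [F.map_comp, F.map_comp, eqToHom_map, eqToHom_map]
    refine .trans ?_ (eqToHom_comp_comp_eqToHom_heq _ _ _).symm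
    rw [hF.tensor_map]
    refine .trans ?_ (eqToHom_comp_comp_eqToHom_heq _ _ _).symm
    exact tensorHom_heq (h₂ _).symm (h₂ _).symm (h₂ _).symm (h₂ _).symm (hG f).symm (hG g).symm
  · refine CategoryTheory.Functor.ext h₁ fun X Y f => F.map_injective (eq_of_heq ?_)
    refine (hG (F.map f)).trans ?_
    rw [F.map_comp, F.map_comp, eqToHom_map, eqToHom_map]
    exact (eqToHom_comp_comp_eqToHom_heq _ _ _).symm
  · refine CategoryTheory.Functor.ext h₂ fun X Y f => ?_
    exact F.map_preimage _

theorem monoidallyEquivalent_of_inverse {F : C ⥤ D} {G : D ⥤ C} (hF : IsStrictMonoidal F)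
    (hG : IsStrictMonoidal G) (h : F ⋙ G = 𝟭 C) (h' : G ⋙ F = 𝟭 D) : MonoidallyEquivalent C D :=
  ⟨F, G, hF, hG, eqToIso h.symm, eqToIso h', isMonoidalTrans_eqToHom _ _ h.symm,
    isMonoidalTrans_eqToHom _ _ h'⟩

end StrictInverse

theorem mainTheorem2 :
    (∃ (F : Bialg.theory.Cat ⥤ MRel) (G : MRel ⥤ Bialg.theory.Cat),
      IsInterpretation F ∧ IsStrictMonoidal G ∧ F ⋙ G = 𝟭 Bialg.theory.Cat ∧ G ⋙ F = 𝟭 MRel) ∧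
    Bialg.theory.IsPresentation MRel := by
  obtain ⟨G, hG, h, h'⟩ := MRel.isInterpretation.strict.exists_inverse
    (fun n => ⟨⟨List.replicate n.card ()⟩⟩)
    -- A word over a one-letter alphabet is determined by its length.
    (fun X => congrArg (fun w => (⟨⟨w⟩⟩ : Bialg.theory.Cat))
      (List.eq_replicate_iff.mpr ⟨rfl, fun _ _ => rfl⟩).symm)
    (fun n => congrArg MRel.of List.length_replicate)
  exact ⟨⟨_, G, MRel.isInterpretation, hG, h, h'⟩,
    monoidallyEquivalent_of_inverse hG MRel.isInterpretation.strict h' h⟩
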